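/- Let $\Sigma$ be a compact connected Riemann surface with canonical bundle $K$. An $SL(2,\mathbb C)$-Higgs bundle on $\Sigma$ is a pair $(V,\varphi)$, where $V$ is a holomorphic rank-two bundle with trivialized determinant, with induced symplectic form $\omega$, and $\varphi:V\to V\otimes K$ is trace-free. An $SO(4,\mathbb C)$-Higgs bundle is $((E,Q,\delta),\Phi)$, where $E$ is a holomorphic bundle of rank $4$ with non-degenerate symmetric form $Q$ and a compatible trivialization $\delta$ of its determinant ($\delta^2=\det Q$), and $\Phi:E\to E\otimes K$ is $Q$-skew. An $SO_0(1,3)$-Higgs bundle is $(W,\beta)$, where $W=(W,q_W,\delta_W)$ is a holomorphic orthogonal bundle of rank $3$ with compatible trivialization of its determinant and $\beta:W\to\mathcal O\otimes K$; viewed as an $SO(4,\mathbb C)$-Higgs bundle it is $\left(\mathcal O\oplus W,\begin{pmatrix}0&\beta\\-\beta^T&0\end{pmatrix}\right)$ with the form $2\oplus q_W$, where $\beta^T=q_W^{-1}\beta^t\cdot 2$. The isogeny $SL(2,\mathbb C)\times SL(2,\mathbb C)\to SO(4,\mathbb C)$, $(g_1,g_2)\mapsto g_1\otimes g_2$, induces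 on Higgs bundles the map $$\mathcal I_2\big((V_1,\varphi_1),(V_2,\varphi_2)\big)=(V_1\otimes V_2,\ \omega_1\otimes\omega_2,\ \varphi_1\otimes \mathrm{Id}+\mathrm{Id}\otimes\varphi_2).$$ The moduli spaces $\mathcal M(SL(2,\mathbb C))$ and $\mathcal M(SO_0(1,3))$ consist of the S-equivalence classes of semistable Higgs bundles, where $(V,\varphi)$ is semistable if every $\varphi$-invariant line subbundle of $V$ has degree $\le 0$, and $(W,\beta)$ is semistable if every isotropic line subbundle $N\subset W$ with $\beta(N)=0$ has degree $\le 0$. $\mathcal M^+(SO_0(1,3))$ is the part of $\mathcal M(SO_0(1,3))$ whose points are represented by $(W,\beta)$ with $w_2(W)=0$. 1. For every $SL(2,\mathbb C)$-Higgs bundle $(V,\varphi)$ there is an isomorphism of $SO(4,\mathbb C)$-Higgs bundles $$\mathcal I_2\big((V,\varphi),(V,-\varphi)\big)\cong\left(\mathcal O\oplus \mathrm{Sym}^2V,\ \begin{pmatrix}0&\beta\\-\beta^T&0\end{pmatrix}\right),$$ given by $V\otimes V=\Lambda^2V\oplus \mathrm{Sym}^2V$, where $\mathrm{Sym}^2V$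 carries the form induced by $\omega\otimes\omega$. In local frames $e,f$ of $V$ with $\omega(e,f)=1$, and the frames $e\otimes f-f\otimes e$ of $\mathcal O=\Lambda^2V$ and $e\otimes e,\ e\otimes f+f\otimes e,\ f\otimes f$ of $\mathrm{Sym}^2V$, one has $\beta=\begin{bmatrix}-c&2a&b\end{bmatrix}$ when $\varphi=\begin{bmatrix}a&b\\c&-a\end{bmatrix}$. 2. Conversely, for every $SO_0(1,3)$-Higgs bundle $(W,\beta)$ with $w_2(W)=0$ there is an $SL(2,\mathbb C)$-Higgs bundle $(V,\varphi)$ (so $V$ has rank two and trivial determinant) and an isomorphism of oriented orthogonal bundles $W\cong \mathrm{Sym}^2V$, which carries $\beta$ to the form described in part 1. 3. If $(V,\varphi)$ is semistable, so is $(\mathrm{Sym}^2V,\beta)$ of part 1, and $(V,\varphi)\mapsto(\mathrm{Sym}^2V,\beta)$ descends to a well-defined map $\mathcal M(SL(2,\mathbb C))\to\mathcal M(SO_0(1,3))$ whose image is exactly $\mathcal M^+(SO_0(1,3))$; that is, the induced map onto $\mathcal M^+(SO_0(1,3))$ is surjective. -/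

import Mathlib

open scoped Manifold ContDiff Topology Kronecker Matrix

universe u

noncomputable section

namespace Higgs

section Surface

variable {X : Type u} [TopologicalSpace X] [ChartedSpace ℂ X]

/-- `f` is holomorphic on the (open) subset `s` of the Riemann surface `X`. -/
def HolOn (f : X → ℂ) (s : Set X) : Prop := MDifferentiableOn 𝓘(ℂ) 𝓘(ℂ) f s

/-- A matrix of holomorphic functions. -/
def HolMat {m n : ℕ} (A : X → Matrix (Fin m) (Fin n) ℂ) (s : Set X) : Prop :=
  ∀ r t, HolOn (fun x => A x r t) s

theorem HolOn.mono {f : X → ℂ} {s t : Set X} (h : HolOn f s) (hts : t ⊆ s) : HolOn f t :=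
  MDifferentiableOn.mono h hts

theorem HolOn.congr {f g : X → ℂ} {s : Set X} (h : HolOn f s) (hg : ∀ x ∈ s, g x = f x) :
    HolOn g s :=
  MDifferentiableOn.congr h hg

theorem holOn_const (c : ℂ) (s : Set X) : HolOn (fun _ => c) s := mdifferentiableOn_const

theorem HolOn.add {f g : X → ℂ} {s : Set X} (hf : HolOn f s) (hg : HolOn g s) :
    HolOn (fun x => f x + g x) s := MDifferentiableOn.add hf hg

theorem HolOn.sub {f g : X → ℂ} {s : Set X} (hf : HolOn f s) (hg : HolOn g s) :
    HolOn (fun x => f x - g x) s := MDifferentiableOn.sub hf hg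

theorem HolOn.neg {f : X → ℂ} {s : Set X} (hf : HolOn f s) :
    HolOn (fun x => -f x) s := MDifferentiableOn.neg hf

theorem HolOn.mul {f g : X → ℂ} {s : Set X} (hf : HolOn f s) (hg : HolOn g s) :
    HolOn (fun x => f x * g x) s := MDifferentiableOn.mul hf hg

theorem HolOn.inv {f : X → ℂ} {s : Set X} (hf : HolOn f s) (h0 : ∀ x ∈ s, f x ≠ 0) :
    HolOn (fun x => (f x)⁻¹) s := MDifferentiableOn.inv hf h0

end Surface

/-- An open cover of `X`. -/
structure Cover (X : Type u) [TopologicalSpace X] where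
  ι : Type u
  U : ι → Set X
  isOpen : ∀ i, IsOpen (U i)
  exists_mem : ∀ x, ∃ i, x ∈ U i

theorem HolMat.mono {m n : ℕ} {X : Type u} [TopologicalSpace X] [ChartedSpace ℂ X]
    {A : X → Matrix (Fin m) (Fin n) ℂ} {s t : Set X} (h : HolMat A s) (hts : t ⊆ s) :
    HolMat A t := fun r k => (h r k).mono hts

section Bundles

variable (X : Type u) [TopologicalSpace X] [ChartedSpace ℂ X]

/-- A holomorphic vector bundle of rank `n`, given by local frames over the members of an open
cover and a holomorphic transition cocycle. Coordinate vectors transform by `v i = g i j * v j`,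
frames by `e j = e i * g i j`. -/
structure HolVB (n : ℕ) extends Cover X where
  g : ι → ι → X → Matrix (Fin n) (Fin n) ℂ
  hol : ∀ i j, HolMat (g i j) (U i ∩ U j)
  g_self : ∀ i, ∀ x ∈ U i, g i i x = 1
  g_comp : ∀ i j k x, x ∈ U i → x ∈ U j → x ∈ U k → g i j x * g j k x = g i k x

theorem differentiableOn_transition [IsManifold 𝓘(ℂ) ω X] {c c' : OpenPartialHomeomorph X ℂ}
    (hc : c ∈ atlas ℂ X) (hc' : c' ∈ atlas ℂ X) :
    DifferentiableOn ℂ (fun z => c' (c.symm z)) (c.symm.trans c').source := by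
  have h := (contDiffGroupoid ω 𝓘(ℂ)).compatible hc hc'
  rw [contDiffGroupoid, mem_groupoid_of_pregroupoid] at h
  have h1 := h.1
  simp only [contDiffPregroupoid, modelWithCornersSelf_coe, modelWithCornersSelf_coe_symm,
    Set.range_id, Set.inter_univ, Set.preimage_id_eq, id_eq, Function.id_comp,
    Function.comp_id] at h1
  exact h1.differentiableOn (by simp)

theorem differentiableAt_transition [IsManifold 𝓘(ℂ) ω X] {c c' : OpenPartialHomeomorph X ℂ}
    (hc : c ∈ atlas ℂ X) (hc' : c' ∈ atlas ℂ X) {x : X} (hx : x ∈ c.source)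
    (hx' : x ∈ c'.source) :
    DifferentiableAt ℂ (fun z => c' (c.symm z)) (c x) := by
  refine (differentiableOn_transition X hc hc').differentiableAt ?_
  refine (c.symm.trans c').open_source.mem_nhds ?_
  simp [hx, hx']

/-- The canonical bundle `K`, with frames `dz` for the charts `z` of `X`; the transition function
from the frame `dz'` to the frame `dz` is `dz' / dz`. -/
def canonical [IsManifold 𝓘(ℂ) ω X] : HolVB X 1 where
  ι := atlas ℂ X
  U c := c.1.source
  isOpen c := c.1.open_source
  exists_mem x := ⟨⟨chartAt ℂ x, chart_mem_atlas ℂ x⟩, mem_chart_source ℂ x⟩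
  g c c' x := !![deriv (fun z => c'.1 (c.1.symm z)) (c.1 x)]
  hol c c' := by
    intro r t
    have h1 : DifferentiableOn ℂ (deriv (fun z => c'.1 (c.1.symm z)))
        (c.1.symm.trans c'.1).source :=
      (differentiableOn_transition X c.2 c'.2).deriv (c.1.symm.trans c'.1).open_source
    have hman : IsManifold 𝓘(ℂ) 1 X := IsManifold.of_le (n := ω) le_top
    have h2 : MDifferentiableOn 𝓘(ℂ) 𝓘(ℂ) c.1 c.1.source := mdifferentiableOn_atlas c.2
    have h3 := h1.mdifferentiableOn.comp (h2.mono (Set.inter_subset_left (t := c'.1.source)))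
      (by
        intro x hx
        simp [hx.1, hx.2])
    have hr : r = 0 := Subsingleton.elim _ _
    have ht : t = 0 := Subsingleton.elim _ _
    subst hr ht
    exact h3
  g_self c x hx := by
    have : (fun z => c.1 (c.1.symm z)) =ᶠ[𝓝 (c.1 x)] id := by
      filter_upwards [c.1.open_target.mem_nhds (c.1.map_source hx)] with z hz
      exact c.1.right_inv hz
    rw [this.deriv_eq]
    ext r t
    have hr : r = 0 := Subsingleton.elim _ _
    have ht : t = 0 := Subsingleton.elim _ _
    subst hr ht
    simp
  g_comp c c' c'' x hx hx' hx'' := by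
    have e : (fun z => c''.1 (c.1.symm z)) =ᶠ[𝓝 (c.1 x)]
        (fun z => c''.1 (c'.1.symm z)) ∘ (fun z => c'.1 (c.1.symm z)) := by
      have hm : (c.1.symm.trans c'.1).source ∈ 𝓝 (c.1 x) := by
        refine (c.1.symm.trans c'.1).open_source.mem_nhds ?_
        simp [hx, hx']
      filter_upwards [hm] with z hz
      have hz2 : c.1.symm z ∈ c'.1.source := by
        simp at hz
        exact hz.2
      simp [c'.1.left_inv hz2]
    have hy : c'.1 (c.1.symm (c.1 x)) = c'.1 x := by rw [c.1.left_inv hx]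
    have hd := differentiableAt_transition X c'.2 c''.2 hx' hx''
    rw [e.deriv_eq, deriv_comp, hy]
    · ext r t
      have hr : r = 0 := Subsingleton.elim _ _
      have ht : t = 0 := Subsingleton.elim _ _
      subst hr ht
      simp [mul_comm]
    · rw [hy]; exact hd
    · exact differentiableAt_transition X c.2 c'.2 hx hx'

end Bundles

section Constructions

variable {X : Type u} [TopologicalSpace X] [ChartedSpace ℂ X]

/-- The trivial bundle `𝒪^n`. -/
def HolVB.trivial (X : Type u) [TopologicalSpace X] [ChartedSpace ℂ X] (n : ℕ) : HolVB X n where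
  ι := PUnit
  U _ := Set.univ
  isOpen _ := isOpen_univ
  exists_mem _ := ⟨PUnit.unit, Set.mem_univ _⟩
  g _ _ _ := 1
  hol _ _ _ _ := holOn_const _ _
  g_self _ _ _ := rfl
  g_comp _ _ _ _ _ _ _ := by simp

/-- The tensor product `E ⊗ F`, with the frames `e_r ⊗ f_t` in lexicographic order. -/
def HolVB.tensor {m n : ℕ} (E : HolVB X m) (F : HolVB X n) : HolVB X (m * n) where
  ι := E.ι × F.ι
  U p := E.U p.1 ∩ F.U p.2
  isOpen p := (E.isOpen p.1).inter (F.isOpen p.2)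
  exists_mem x := by
    obtain ⟨i, hi⟩ := E.exists_mem x
    obtain ⟨k, hk⟩ := F.exists_mem x
    exact ⟨(i, k), hi, hk⟩
  g p p' x := Matrix.reindex finProdFinEquiv finProdFinEquiv (E.g p.1 p'.1 x ⊗ₖ F.g p.2 p'.2 x)
  hol p p' r t := by
    refine HolOn.mul ((E.hol p.1 p'.1 _ _).mono ?_) ((F.hol p.2 p'.2 _ _).mono ?_)
    · exact fun x hx => ⟨hx.1.1, hx.2.1⟩
    · exact fun x hx => ⟨hx.1.2, hx.2.2⟩
  g_self p x hx := by
    simp [E.g_self _ x hx.1, F.g_self _ x hx.2]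
  g_comp p p' p'' x h h' h'' := by
    simp only [Matrix.reindex_apply, Matrix.submatrix_mul_equiv, ← Matrix.mul_kronecker_mul]
    rw [E.g_comp _ _ _ x h.1 h'.1 h''.1, F.g_comp _ _ _ x h.2 h'.2 h''.2]

/-- The direct sum `E ⊕ F`, with the frames of `E` followed by those of `F`. -/
def HolVB.directSum {m n : ℕ} (E : HolVB X m) (F : HolVB X n) : HolVB X (m + n) where
  ι := E.ι × F.ι
  U p := E.U p.1 ∩ F.U p.2
  isOpen p := (E.isOpen p.1).inter (F.isOpen p.2)
  exists_mem x := by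
    obtain ⟨i, hi⟩ := E.exists_mem x
    obtain ⟨k, hk⟩ := F.exists_mem x
    exact ⟨(i, k), hi, hk⟩
  g p p' x := Matrix.reindex finSumFinEquiv finSumFinEquiv
    (Matrix.fromBlocks (E.g p.1 p'.1 x) 0 0 (F.g p.2 p'.2 x))
  hol p p' r t := by
    simp only [Matrix.reindex_apply, Matrix.submatrix_apply]
    rcases finSumFinEquiv.symm r with a | a <;> rcases finSumFinEquiv.symm t with b | b
    · exact (E.hol p.1 p'.1 _ _).mono fun x hx => ⟨hx.1.1, hx.2.1⟩
    · exact holOn_const _ _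
    · exact holOn_const _ _
    · exact (F.hol p.2 p'.2 _ _).mono fun x hx => ⟨hx.1.2, hx.2.2⟩
  g_self p x hx := by
    simp [E.g_self _ x hx.1, F.g_self _ x hx.2]
  g_comp p p' p'' x h h' h'' := by
    simp only [Matrix.reindex_apply, Matrix.submatrix_mul_equiv, Matrix.fromBlocks_multiply]
    simp [E.g_comp _ _ _ x h.1 h'.1 h''.1, F.g_comp _ _ _ x h.2 h'.2 h''.2]

/-- A holomorphic bundle map `E → F`: matrices `f a i` from the `i`-th frame of `E` to the `a`-th
frame of `F`. -/
structure VBHom {m n : ℕ} (E : HolVB X m) (F : HolVB X n) where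
  f : F.ι → E.ι → X → Matrix (Fin n) (Fin m) ℂ
  hol : ∀ a i, HolMat (f a i) (F.U a ∩ E.U i)
  compat : ∀ a b i j x, x ∈ F.U a → x ∈ F.U b → x ∈ E.U i → x ∈ E.U j →
    f b j x = F.g b a x * f a i x * E.g i j x

/-- A holomorphic bundle map `E → F ⊗ K`: on the overlap of the `i`-th frame of `E`, the `a`-th
frame of `F` and the chart `z` it is `f a i z` times `dz`. -/
structure TwistedHom [IsManifold 𝓘(ℂ) ω X] {m n : ℕ} (E : HolVB X m) (F : HolVB X n) where
  f : F.ι → E.ι → (canonical X).ι → X → Matrix (Fin n) (Fin m) ℂ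
  hol : ∀ a i c, HolMat (f a i c) (F.U a ∩ E.U i ∩ (canonical X).U c)
  compat : ∀ a b i j c d x, x ∈ F.U a → x ∈ F.U b → x ∈ E.U i → x ∈ E.U j →
    x ∈ (canonical X).U c → x ∈ (canonical X).U d →
    f b j d x = (canonical X).g d c x 0 0 • (F.g b a x * f a i c x * E.g i j x)

end Constructions

section Algebra

/-- The symplectic form `ω` of `ℂ²`: `ω(e, f) = 1`. -/
def J : Matrix (Fin 2) (Fin 2) ℂ := !![0, 1; -1, 0]

/-- The orthogonal structure on `𝒪`. -/
def q₁ : Matrix (Fin 1) (Fin 1) ℂ := !![2]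

/-- The restriction of `ω ⊗ ω` to `Sym² ℂ²`, in the basis `e ⊗ e`, `e ⊗ f + f ⊗ e`, `f ⊗ f`. -/
def q₃ : Matrix (Fin 3) (Fin 3) ℂ := !![0, 0, 1; 0, -2, 0; 1, 0, 0]

/-- The matrix of `Sym² A`, in the basis `e ⊗ e`, `e ⊗ f + f ⊗ e`, `f ⊗ f`; on `SL(2, ℂ)` this is
the double covering `Spin(3, ℂ) = SL(2, ℂ) → SO(3, ℂ)`. -/
def sym2Mat (A : Matrix (Fin 2) (Fin 2) ℂ) : Matrix (Fin 3) (Fin 3) ℂ :=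
  !![A 0 0 ^ 2, 2 * (A 0 0 * A 0 1), A 0 1 ^ 2;
     A 0 0 * A 1 0, A 0 0 * A 1 1 + A 0 1 * A 1 0, A 0 1 * A 1 1;
     A 1 0 ^ 2, 2 * (A 1 0 * A 1 1), A 1 1 ^ 2]

theorem sym2Mat_one : sym2Mat 1 = 1 := by
  ext r t; fin_cases r <;> fin_cases t <;> simp [sym2Mat]

theorem sym2Mat_mul (A B : Matrix (Fin 2) (Fin 2) ℂ) :
    sym2Mat (A * B) = sym2Mat A * sym2Mat B := by
  ext r t
  fin_cases r <;> fin_cases t <;>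
    simp [sym2Mat, Matrix.mul_apply, Fin.sum_univ_succ] <;> ring

theorem sym2Mat_isometry {A : Matrix (Fin 2) (Fin 2) ℂ} (h : A.det = 1) :
    (sym2Mat A)ᵀ * q₃ * sym2Mat A = q₃ := by
  rw [Matrix.det_fin_two] at h
  ext r t
  fin_cases r <;> fin_cases t <;>
    simp [sym2Mat, q₃, Matrix.mul_apply, Fin.sum_univ_succ] <;> grind

theorem det_sym2Mat {A : Matrix (Fin 2) (Fin 2) ℂ} (h : A.det = 1) : (sym2Mat A).det = 1 := by
  rw [Matrix.det_fin_two] at h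
  rw [Matrix.det_fin_three]
  simp [sym2Mat]
  grind

theorem det_q₃ : q₃.det = 2 := by
  rw [Matrix.det_fin_three]; simp [q₃]

theorem J_isometry {A : Matrix (Fin 2) (Fin 2) ℂ} (h : A.det = 1) : Aᵀ * J * A = J := by
  rw [Matrix.det_fin_two] at h
  ext r t
  fin_cases r <;> fin_cases t <;>
    simp [J, Matrix.mul_apply, Fin.sum_univ_succ] <;> grind

theorem J_skew {A : Matrix (Fin 2) (Fin 2) ℂ} (h : A.trace = 0) : Aᵀ * J + J * A = 0 := by
  rw [Matrix.trace_fin_two] at h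
  ext r t
  fin_cases r <;> fin_cases t <;>
    simp [J, Matrix.mul_apply, Fin.sum_univ_succ, Matrix.vecMul, dotProduct] <;> grind

/-- The row `β = [-c, 2a, b]` of the matrix `φ = [[a, b], [c, -a]]`. -/
def betaMat (M : Matrix (Fin 2) (Fin 2) ℂ) : Matrix (Fin 1) (Fin 3) ℂ :=
  !![-M 1 0, 2 * M 0 0, M 0 1]

theorem eq_adjugate_of_mul_eq_one {A B : Matrix (Fin 2) (Fin 2) ℂ} (hA : A.det = 1)
    (h : B * A = 1) : B = !![A 1 1, -A 0 1; -A 1 0, A 0 0] := by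
  rw [← Matrix.adjugate_fin_two]
  have h2 : A * A.adjugate = 1 := by rw [Matrix.mul_adjugate, hA, one_smul]
  calc B = B * (A * A.adjugate) := by rw [h2, mul_one]
    _ = A.adjugate := by rw [← mul_assoc, h, one_mul]

theorem betaMat_conj {A B M : Matrix (Fin 2) (Fin 2) ℂ} (hA : A.det = 1) (h : B * A = 1)
    (hM : M.trace = 0) : betaMat (B * M * A) = betaMat M * sym2Mat A := by
  rw [eq_adjugate_of_mul_eq_one hA h]
  rw [Matrix.trace_fin_two] at hM
  rw [Matrix.det_fin_two] at hA
  ext r t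
  fin_cases r
  fin_cases t <;>
    simp [betaMat, sym2Mat, Matrix.mul_apply, Fin.sum_univ_succ, Matrix.vecMul, dotProduct] <;>
    grind

theorem betaMat_smul (k : ℂ) (M : Matrix (Fin 2) (Fin 2) ℂ) :
    betaMat (k • M) = k • betaMat M := by
  ext r t
  fin_cases r
  fin_cases t <;> simp [betaMat]
  ring

end Algebra

section Objects

variable (X : Type u) [TopologicalSpace X] [ChartedSpace ℂ X]

/-- A rank two bundle with trivial determinant: the local frames `e, f` are those with
`ω(e, f) = 1` for the symplectic form `ω` given by the trivialization of the determinant, so that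
the transition cocycle has values in `SL(2, ℂ)`. -/
structure SL2Bundle extends HolVB X 2 where
  det_g : ∀ i j x, x ∈ U i → x ∈ U j → (g i j x).det = 1

/-- An oriented orthogonal bundle `(E, q, δ)` of rank `n`: a non-degenerate symmetric form `q` on
`E`, with Gram matrix `q i` in the `i`-th frame, and a trivialization `δ` of the determinant of `E`
compatible with `q`, with value `δ i` on the exterior product of the `i`-th frame. -/
structure SOBundle (n : ℕ) extends HolVB X n where
  q : ι → X → Matrix (Fin n) (Fin n) ℂ
  q_hol : ∀ i, HolMat (q i) (U i)
  q_symm : ∀ i, ∀ x ∈ U i, (q i x)ᵀ = q i x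
  q_compat : ∀ i j x, x ∈ U i → x ∈ U j → q j x = (g i j x)ᵀ * q i x * g i j x
  δ : ι → X → ℂ
  δ_hol : ∀ i, HolOn (δ i) (U i)
  δ_compat : ∀ i j x, x ∈ U i → x ∈ U j → δ j x = (g i j x).det * δ i x
  δ_sq : ∀ i, ∀ x ∈ U i, δ i x ^ 2 = (q i x).det
  δ_ne_zero : ∀ i, ∀ x ∈ U i, δ i x ≠ 0

variable [IsManifold 𝓘(ℂ) ω X]

/-- An `SL(2, ℂ)`-Higgs bundle `(V, φ)`. -/
structure SL2Higgs extends SL2Bundle X where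
  φ : TwistedHom toHolVB toHolVB
  trace_φ : ∀ i c x, x ∈ U i → x ∈ (canonical X).U c → (φ.f i i c x).trace = 0

/-- An `SO(n, ℂ)`-Higgs bundle `((E, q, δ), Φ)`. -/
structure SOHiggs (n : ℕ) extends SOBundle X n where
  Φ : TwistedHom toHolVB toHolVB
  skew : ∀ i c x, x ∈ U i → x ∈ (canonical X).U c →
    (Φ.f i i c x)ᵀ * q i x + q i x * Φ.f i i c x = 0

/-- An `SO₀(1, 3)`-Higgs bundle: an oriented orthogonal bundle `W` of rank three together with
`β : W → 𝒪 ⊗ K`. -/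
structure SO13Higgs extends SOBundle X 3 where
  β : TwistedHom toHolVB (HolVB.trivial X 1)

end Objects

section Maps

variable {X : Type u} [TopologicalSpace X] [ChartedSpace ℂ X]

/-- The orthogonal bundle `Sym² V`, in the frames `e ⊗ e`, `e ⊗ f + f ⊗ e`, `f ⊗ f`, with the form
induced by `ω ⊗ ω`. -/
def SL2Bundle.sym2 (V : SL2Bundle X) : SOBundle X 3 where
  toCover := V.toCover
  g i j x := sym2Mat (V.g i j x)
  hol i j := by
    have h := V.hol i j
    intro r t
    fin_cases r <;> fin_cases t <;> simp only [sym2Mat, pow_two] <;>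
      first
        | exact (h _ _).mul (h _ _)
        | exact (holOn_const 2 _).mul ((h _ _).mul (h _ _))
        | exact ((h _ _).mul (h _ _)).add ((h _ _).mul (h _ _))
  g_self i x hx := by rw [V.g_self i x hx, sym2Mat_one]
  g_comp i j k x hi hj hk := by rw [← sym2Mat_mul, V.g_comp i j k x hi hj hk]
  q _ _ := q₃
  q_hol _ _ _ := holOn_const _ _
  q_symm _ _ _ := by
    ext r t; fin_cases r <;> fin_cases t <;> simp [q₃]
  q_compat i j x hi hj := (sym2Mat_isometry (V.det_g i j x hi hj)).symm
  δ _ _ := -(Real.sqrt 2 : ℂ)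
  δ_hol _ := holOn_const _ _
  δ_compat i j x hi hj := by simp [det_sym2Mat (V.det_g i j x hi hj)]
  δ_sq _ _ _ := by
    rw [det_q₃, neg_sq, ← Complex.ofReal_pow, Real.sq_sqrt (by norm_num)]
    norm_num
  δ_ne_zero _ _ _ := by
    simp

/-- The orthogonal bundle `(V₁ ⊗ V₂, ω₁ ⊗ ω₂)`; this is the bundle obtained from the transition
cocycle `(g₁, g₂)` by applying the isogeny `(g₁, g₂) ↦ g₁ ⊗ g₂`. -/
def SL2Bundle.tensor (V₁ V₂ : SL2Bundle X) : SOBundle X 4 where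
  toHolVB := HolVB.tensor V₁.toHolVB V₂.toHolVB
  q _ _ := Matrix.reindex finProdFinEquiv finProdFinEquiv (J ⊗ₖ J)
  q_hol _ _ _ := holOn_const _ _
  q_symm _ _ _ := by
    ext r t; fin_cases r <;> fin_cases t <;>
      simp [J, finProdFinEquiv, Fin.divNat, Fin.modNat]
  q_compat p p' x h h' := by
    simp only [HolVB.tensor, Matrix.reindex_apply, Matrix.transpose_submatrix,
      Matrix.submatrix_mul_equiv]
    rw [← Matrix.kroneckerMap_transpose, ← Matrix.mul_kronecker_mul, ← Matrix.mul_kronecker_mul,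
      J_isometry (V₁.det_g _ _ x h.1 h'.1), J_isometry (V₂.det_g _ _ x h.2 h'.2)]
  δ _ _ := 1
  δ_hol _ := holOn_const _ _
  δ_compat p p' x h h' := by
    simp only [HolVB.tensor]
    erw [Matrix.det_reindex_self]
    rw [Matrix.det_kronecker, V₁.det_g _ _ x h.1 h'.1, V₂.det_g _ _ x h.2 h'.2]
    simp
  δ_sq _ _ _ := by
    erw [Matrix.det_reindex_self]
    rw [Matrix.det_kronecker]
    simp [J]
  δ_ne_zero _ _ _ := one_ne_zero

theorem SOBundle.det_q_ne_zero {n : ℕ} (W : SOBundle X n) {i : W.ι} {x : X} (hx : x ∈ W.U i) :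
    (W.q i x).det ≠ 0 := by
  rw [← W.δ_sq i x hx]
  exact pow_ne_zero 2 (W.δ_ne_zero i x hx)

/-- The oriented orthogonal bundle `𝒪 ⊕ W`, where the orthogonal structure on `𝒪` is `2` (and
hence its orientation has the value `√2` on the frame `1`). -/
def SOBundle.addLine (W : SOBundle X 3) : SOBundle X 4 where
  toHolVB := HolVB.directSum (HolVB.trivial X 1) W.toHolVB
  q p x := Matrix.reindex finSumFinEquiv finSumFinEquiv
    (Matrix.fromBlocks q₁ 0 0 (W.q p.2 x))
  q_hol p r t := by
    simp only [Matrix.reindex_apply, Matrix.submatrix_apply]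
    generalize (finSumFinEquiv (m := 1) (n := 3)).symm r = r'
    generalize (finSumFinEquiv (m := 1) (n := 3)).symm t = t'
    rcases r' with a | a <;> rcases t' with b | b
    · exact holOn_const _ _
    · exact holOn_const _ _
    · exact holOn_const _ _
    · exact (W.q_hol p.2 _ _).mono fun x hx => hx.2
  q_symm p x hx := by
    simp only [Matrix.reindex_apply, Matrix.transpose_submatrix, Matrix.fromBlocks_transpose,
      W.q_symm p.2 x hx.2]
    congr 1
    ext r t
    rcases r with a | a <;> rcases t with b | b <;> simp [q₁]
  q_compat p p' x h h' := by
    simp only [HolVB.directSum, HolVB.trivial, Matrix.reindex_apply, Matrix.transpose_submatrix,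
      Matrix.submatrix_mul_equiv, Matrix.fromBlocks_transpose, Matrix.fromBlocks_multiply]
    rw [W.q_compat p.2 p'.2 x h.2 h'.2]
    simp
  δ p x := (Real.sqrt 2 : ℂ) * W.δ p.2 x
  δ_hol p := (holOn_const _ _).mul ((W.δ_hol p.2).mono fun x hx => hx.2)
  δ_compat p p' x h h' := by
    simp only [HolVB.directSum, HolVB.trivial]
    erw [Matrix.det_reindex_self]
    rw [Matrix.det_fromBlocks_zero₂₁, W.δ_compat p.2 p'.2 x h.2 h'.2]
    simp
    ring
  δ_sq p x hx := by
    erw [Matrix.det_reindex_self]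
    rw [Matrix.det_fromBlocks_zero₂₁, mul_pow, W.δ_sq p.2 x hx.2, ← Complex.ofReal_pow,
      Real.sq_sqrt (by norm_num)]
    simp [q₁]
  δ_ne_zero p x hx := by
    simp [W.δ_ne_zero p.2 x hx.2]

theorem SOBundle.hol_inv_q (W : SOBundle X 3) (i : W.ι) : HolMat (fun x => (W.q i x)⁻¹) (W.U i) := by
  intro r t
  have h := W.q_hol i
  have hd : HolOn (fun x => ((W.δ i x) ^ 2)⁻¹) (W.U i) := by
    simp only [pow_two]
    refine HolOn.inv ((W.δ_hol i).mul (W.δ_hol i)) fun x hx => ?_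
    exact mul_ne_zero (W.δ_ne_zero i x hx) (W.δ_ne_zero i x hx)
  have ha : HolOn (fun x => (W.q i x).adjugate r t) (W.U i) := by
    simp only [Matrix.adjugate_fin_three]
    fin_cases r <;> fin_cases t
    · exact ((h _ _).mul (h _ _)).sub ((h _ _).mul (h _ _))
    · exact ((h _ _).mul (h _ _)).neg.add ((h _ _).mul (h _ _))
    · exact ((h _ _).mul (h _ _)).sub ((h _ _).mul (h _ _))
    · exact ((h _ _).mul (h _ _)).neg.add ((h _ _).mul (h _ _))
    · exact ((h _ _).mul (h _ _)).sub ((h _ _).mul (h _ _))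
    · exact ((h _ _).mul (h _ _)).neg.add ((h _ _).mul (h _ _))
    · exact ((h _ _).mul (h _ _)).sub ((h _ _).mul (h _ _))
    · exact ((h _ _).mul (h _ _)).neg.add ((h _ _).mul (h _ _))
    · exact ((h _ _).mul (h _ _)).sub ((h _ _).mul (h _ _))
  refine (hd.mul ha).congr fun x hx => ?_
  show (W.q i x)⁻¹ r t = _
  rw [Matrix.inv_def, W.δ_sq i x hx, Ring.inverse_eq_inv']
  simp

variable [IsManifold 𝓘(ℂ) ω X]

/-- The map `-Φ`. -/
def TwistedHom.neg {m n : ℕ} {E : HolVB X m} {F : HolVB X n} (Φ : TwistedHom E F) :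
    TwistedHom E F where
  f a i c x := -Φ.f a i c x
  hol a i c r t := (Φ.hol a i c r t).neg
  compat a b i j c d x ha hb hi hj hc hd := by
    rw [Φ.compat a b i j c d x ha hb hi hj hc hd]
    simp

/-- The `SL(2, ℂ)`-Higgs bundle `(V, -φ)`. -/
def SL2Higgs.neg (H : SL2Higgs X) : SL2Higgs X where
  toSL2Bundle := H.toSL2Bundle
  φ := H.φ.neg
  trace_φ i c x hi hc := by
    simp [TwistedHom.neg, H.trace_φ i c x hi hc]

/-- The map on Higgs bundles induced by the isogeny `SL(2, ℂ) × SL(2, ℂ) → SO(4, ℂ)`: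
`((V₁, φ₁), (V₂, φ₂)) ↦ (V₁ ⊗ V₂, ω₁ ⊗ ω₂, φ₁ ⊗ Id + Id ⊗ φ₂)`. -/
def isogeny (H₁ H₂ : SL2Higgs X) : SOHiggs X 4 where
  toSOBundle := H₁.toSL2Bundle.tensor H₂.toSL2Bundle
  Φ :=
    { f := fun p p' c x => Matrix.reindex finProdFinEquiv finProdFinEquiv
        (H₁.φ.f p.1 p'.1 c x ⊗ₖ H₂.g p.2 p'.2 x + H₁.g p.1 p'.1 x ⊗ₖ H₂.φ.f p.2 p'.2 c x)
      hol := by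
        intro p p' c r t
        refine HolOn.add (HolOn.mul ?_ ?_) (HolOn.mul ?_ ?_)
        · exact (H₁.φ.hol p.1 p'.1 c _ _).mono fun x hx => ⟨⟨hx.1.1.1, hx.1.2.1⟩, hx.2⟩
        · exact (H₂.hol p.2 p'.2 _ _).mono fun x hx => ⟨hx.1.1.2, hx.1.2.2⟩
        · exact (H₁.hol p.1 p'.1 _ _).mono fun x hx => ⟨hx.1.1.1, hx.1.2.1⟩
        · exact (H₂.φ.hol p.2 p'.2 c _ _).mono fun x hx => ⟨⟨hx.1.1.2, hx.1.2.2⟩, hx.2⟩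
      compat := by
        intro a b i j c d x ha hb hi hj hc hd
        have e1 : H₁.g b.1 j.1 x = H₁.g b.1 a.1 x * H₁.g a.1 i.1 x * H₁.g i.1 j.1 x := by
          rw [H₁.g_comp _ _ _ x hb.1 ha.1 hi.1, H₁.g_comp _ _ _ x hb.1 hi.1 hj.1]
        have e2 : H₂.g b.2 j.2 x = H₂.g b.2 a.2 x * H₂.g a.2 i.2 x * H₂.g i.2 j.2 x := by
          rw [H₂.g_comp _ _ _ x hb.2 ha.2 hi.2, H₂.g_comp _ _ _ x hb.2 hi.2 hj.2]
        rw [H₁.φ.compat a.1 b.1 i.1 j.1 c d x ha.1 hb.1 hi.1 hj.1 hc hd,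
          H₂.φ.compat a.2 b.2 i.2 j.2 c d x ha.2 hb.2 hi.2 hj.2 hc hd, e1, e2]
        simp only [SL2Bundle.tensor, HolVB.tensor, Matrix.reindex_apply,
          Matrix.submatrix_mul_equiv, mul_add, add_mul, ← Matrix.mul_kronecker_mul,
          Matrix.smul_kronecker, Matrix.kronecker_smul, ← smul_add, Matrix.submatrix_smul,
          Pi.smul_apply] }
  skew p c x hp hc := by
    simp only [SL2Bundle.tensor, Matrix.reindex_apply, Matrix.transpose_submatrix,
      Matrix.submatrix_mul_equiv]
    rw [H₁.g_self _ x hp.1, H₂.g_self _ x hp.2, Matrix.transpose_add,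
      ← Matrix.kroneckerMap_transpose, ← Matrix.kroneckerMap_transpose, add_mul, mul_add,
      ← Matrix.mul_kronecker_mul, ← Matrix.mul_kronecker_mul, ← Matrix.mul_kronecker_mul,
      ← Matrix.mul_kronecker_mul]
    have h1 := J_skew (H₁.trace_φ _ c x hp.1 hc)
    have h2 := J_skew (H₂.trace_φ _ c x hp.2 hc)
    have h1' := eq_neg_of_add_eq_zero_left h1
    have h2' := eq_neg_of_add_eq_zero_left h2
    rw [h1', h2']
    ext r t
    simp
    ring

/-- The `SO₀(1, 3)`-Higgs bundle `(Sym² V, β)` with `β = [-c, 2a, b]` for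
`φ = [[a, b], [c, -a]]`. -/
def SL2Higgs.sym2 (H : SL2Higgs X) : SO13Higgs X where
  toSOBundle := H.toSL2Bundle.sym2
  β :=
    { f := fun _ i c x => betaMat (H.φ.f i i c x)
      hol := by
        intro a i c r t
        have h : ∀ r t, HolOn (fun x => H.φ.f i i c x r t)
            ((HolVB.trivial X 1).U a ∩ H.U i ∩ (canonical X).U c) :=
          fun r t => (H.φ.hol i i c r t).mono fun x hx => ⟨⟨hx.1.2, hx.1.2⟩, hx.2⟩
        fin_cases r
        fin_cases t
        · exact (h _ _).neg
        · exact (holOn_const 2 _).mul (h _ _)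
        · exact h _ _
      compat := by
        intro a b i j c d x ha hb hi hj hc hd
        have hg : H.g j i x * H.g i j x = 1 := by
          rw [H.g_comp _ _ _ x hj hi hj, H.g_self _ x hj]
        rw [H.φ.compat i j i j c d x hi hj hi hj hc hd, betaMat_smul,
          betaMat_conj (H.det_g i j x hi hj) hg (H.trace_φ i c x hi hc)]
        simp [HolVB.trivial, SL2Bundle.sym2] }

/-- The transpose `βᵀ = q_W⁻¹ βᵗ q_𝒪` of `β` with respect to the forms on `W` and `𝒪`. -/
def SO13Higgs.betaT (H : SO13Higgs X) (i : H.ι) (c : (canonical X).ι) (x : X) :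
    Matrix (Fin 3) (Fin 1) ℂ :=
  (H.q i x)⁻¹ * (H.β.f PUnit.unit i c x)ᵀ * q₁

theorem SO13Higgs.hol_betaT (H : SO13Higgs X) (i : H.ι) (c : (canonical X).ι) :
    HolMat (H.betaT i c) (H.U i ∩ (canonical X).U c) := by
  intro a b
  have hq : ∀ k, HolOn (fun x => (H.q i x)⁻¹ a k) (H.U i ∩ (canonical X).U c) := fun k =>
    (H.hol_inv_q i a k).mono fun x hx => hx.1
  have hb : ∀ k, HolOn (fun x => H.β.f PUnit.unit i c x 0 k) (H.U i ∩ (canonical X).U c) :=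
    fun k => (H.β.hol PUnit.unit i c 0 k).mono fun x hx => ⟨⟨trivial, hx.1⟩, hx.2⟩
  have hb0 : b = 0 := Subsingleton.elim _ _
  subst hb0
  refine (((((hq 0).mul (hb 0)).add ((hq 1).mul (hb 1))).add
    ((hq 2).mul (hb 2))).mul (holOn_const 2 _)).congr fun x _ => ?_
  simp [betaT, q₁, Matrix.mul_apply, Fin.sum_univ_three]

theorem SO13Higgs.beta_compat (H : SO13Higgs X) {i j : H.ι} {c d : (canonical X).ι} {x : X}
    (hi : x ∈ H.U i) (hj : x ∈ H.U j) (hc : x ∈ (canonical X).U c) (hd : x ∈ (canonical X).U d) :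
    H.β.f PUnit.unit j d x =
      (canonical X).g d c x 0 0 • (H.β.f PUnit.unit i c x * H.g i j x) := by
  rw [H.β.compat PUnit.unit PUnit.unit i j c d x trivial trivial hi hj hc hd]
  simp [HolVB.trivial]

theorem SO13Higgs.betaT_compat (H : SO13Higgs X) {i j : H.ι} {c d : (canonical X).ι} {x : X}
    (hi : x ∈ H.U i) (hj : x ∈ H.U j) (hc : x ∈ (canonical X).U c) (hd : x ∈ (canonical X).U d) :
    H.betaT j d x = (canonical X).g d c x 0 0 • (H.g j i x * H.betaT i c x) := by
  have e4 : H.g j i x * H.g i j x = 1 := by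
    rw [H.g_comp _ _ _ x hj hi hj, H.g_self _ x hj]
  have e5 : (H.g i j x)⁻¹ = H.g j i x := Matrix.inv_eq_left_inv e4
  have e6 : (H.g i j x)ᵀ⁻¹ * (H.g i j x)ᵀ = 1 := by
    have e : H.g i j x * H.g j i x = 1 := by
      rw [H.g_comp _ _ _ x hi hj hi, H.g_self _ x hi]
    rw [← Matrix.transpose_nonsing_inv, e5, ← Matrix.transpose_mul, e, Matrix.transpose_one]
  unfold betaT
  rw [H.q_compat i j x hi hj, H.beta_compat hi hj hc hd, Matrix.mul_inv_rev, Matrix.mul_inv_rev,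
    e5, Matrix.transpose_smul, Matrix.transpose_mul, Matrix.mul_smul, Matrix.smul_mul]
  congr 1
  calc H.g j i x * ((H.q i x)⁻¹ * (H.g i j x)ᵀ⁻¹) *
        ((H.g i j x)ᵀ * (H.β.f PUnit.unit i c x)ᵀ) * q₁
      = H.g j i x * ((H.q i x)⁻¹ * (((H.g i j x)ᵀ⁻¹ * (H.g i j x)ᵀ) *
          (H.β.f PUnit.unit i c x)ᵀ) * q₁) := by simp only [Matrix.mul_assoc]
    _ = _ := by rw [e6, Matrix.one_mul]

theorem SO13Higgs.q_mul_betaT (H : SO13Higgs X) {i : H.ι} (c : (canonical X).ι) {x : X}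
    (hi : x ∈ H.U i) : H.q i x * H.betaT i c x = (H.β.f PUnit.unit i c x)ᵀ * q₁ := by
  have hu : IsUnit (H.q i x).det := (H.det_q_ne_zero hi).isUnit
  unfold betaT
  rw [← Matrix.mul_assoc, ← Matrix.mul_assoc, Matrix.mul_nonsing_inv _ hu, Matrix.one_mul]

theorem SO13Higgs.betaT_transpose_mul_q (H : SO13Higgs X) {i : H.ι} (c : (canonical X).ι) {x : X}
    (hi : x ∈ H.U i) : (H.betaT i c x)ᵀ * H.q i x = q₁ * H.β.f PUnit.unit i c x := by
  have := congrArg Matrix.transpose (H.q_mul_betaT c hi)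
  rw [Matrix.transpose_mul, H.q_symm i x hi] at this
  rw [this, Matrix.transpose_mul, Matrix.transpose_transpose]
  congr 1
  ext r t
  simp [q₁]

/-- The `SO(4, ℂ)`-Higgs bundle `(𝒪 ⊕ W, [[0, β], [-βᵀ, 0]])`. -/
def SO13Higgs.toSO4 (H : SO13Higgs X) : SOHiggs X 4 where
  toSOBundle := H.toSOBundle.addLine
  Φ :=
    { f := fun p p' c x => Matrix.reindex (finSumFinEquiv (m := 1) (n := 3))
        (finSumFinEquiv (m := 1) (n := 3))
        (Matrix.fromBlocks 0 (H.β.f PUnit.unit p'.2 c x) (-H.betaT p.2 c x) 0)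
      hol := by
        intro p p' c r t
        simp only [Matrix.reindex_apply, Matrix.submatrix_apply]
        generalize (finSumFinEquiv (m := 1) (n := 3)).symm r = r'
        generalize (finSumFinEquiv (m := 1) (n := 3)).symm t = t'
        rcases r' with a | a <;> rcases t' with b | b
        · exact holOn_const _ _
        · exact (H.β.hol PUnit.unit p'.2 c _ _).mono fun x hx =>
            ⟨⟨hx.1.1.1, hx.1.2.2⟩, hx.2⟩
        · exact ((H.hol_betaT p.2 c a b).mono fun x hx => ⟨hx.1.1.2, hx.2⟩).neg
        · exact holOn_const _ _
      compat := by
        rintro ⟨a1, a⟩ ⟨b1, b⟩ ⟨i1, i⟩ ⟨j1, j⟩ c d x ha hb hi hj hc hd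
        dsimp only
        rw [H.betaT_compat ha.2 hb.2 hc hd, H.beta_compat hi.2 hj.2 hc hd]
        simp only [SOBundle.addLine, HolVB.directSum, HolVB.trivial, Matrix.reindex_apply,
          Matrix.submatrix_mul_equiv, Matrix.fromBlocks_multiply]
        ext r t
        simp only [Matrix.submatrix_apply, Matrix.smul_apply]
        generalize (finSumFinEquiv (m := 1) (n := 3)).symm r = r'
        generalize (finSumFinEquiv (m := 1) (n := 3)).symm t = t'
        rcases r' with a | a <;> rcases t' with b | b <;> simp }
  skew := by
    rintro ⟨p1, p⟩ c x hp hc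
    simp only [SOBundle.addLine, Matrix.reindex_apply, Matrix.transpose_submatrix,
      Matrix.submatrix_mul_equiv, Matrix.fromBlocks_transpose, Matrix.fromBlocks_multiply]
    have h2 := H.q_mul_betaT c hp.2
    have h3 := H.betaT_transpose_mul_q c hp.2
    ext r t
    simp only [Matrix.submatrix_apply, Matrix.add_apply]
    generalize (finSumFinEquiv (m := 1) (n := 3)).symm r = r'
    generalize (finSumFinEquiv (m := 1) (n := 3)).symm t = t'
    rcases r' with a | a <;> rcases t' with b | b <;> simp [h2, h3]

end Maps

section Isomorphisms

variable {X : Type u} [TopologicalSpace X] [ChartedSpace ℂ X] [IsManifold 𝓘(ℂ) ω X]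

/-- An isomorphism of `SL(2, ℂ)`-Higgs bundles. -/
structure SL2Higgs.Iso (H H' : SL2Higgs X) extends VBHom H.toHolVB H'.toHolVB where
  det_f : ∀ a i x, x ∈ H'.U a → x ∈ H.U i → (f a i x).det = 1
  comm : ∀ a i c x, x ∈ H'.U a → x ∈ H.U i → x ∈ (canonical X).U c →
    H'.φ.f a a c x * f a i x = f a i x * H.φ.f i i c x

/-- An isomorphism of `SO(n, ℂ)`-Higgs bundles: an orientation-preserving isometry commuting with
the Higgs fields. -/
structure SOHiggs.Iso {n : ℕ} (H H' : SOHiggs X n) extends VBHom H.toHolVB H'.toHolVB where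
  isometry : ∀ a i x, x ∈ H'.U a → x ∈ H.U i → (f a i x)ᵀ * H'.q a x * f a i x = H.q i x
  orient : ∀ a i x, x ∈ H'.U a → x ∈ H.U i → (f a i x).det * H'.δ a x = H.δ i x
  comm : ∀ a i c x, x ∈ H'.U a → x ∈ H.U i → x ∈ (canonical X).U c →
    H'.Φ.f a a c x * f a i x = f a i x * H.Φ.f i i c x

/-- An isomorphism of `SO₀(1, 3)`-Higgs bundles: an orientation-preserving isometry of the rank
three bundles (together with the identity of `𝒪`) commuting with `β`. -/
structure SO13Higgs.Iso (H H' : SO13Higgs X) extends VBHom H.toHolVB H'.toHolVB where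
  isometry : ∀ a i x, x ∈ H'.U a → x ∈ H.U i → (f a i x)ᵀ * H'.q a x * f a i x = H.q i x
  orient : ∀ a i x, x ∈ H'.U a → x ∈ H.U i → (f a i x).det * H'.δ a x = H.δ i x
  comm : ∀ a i c x, x ∈ H'.U a → x ∈ H.U i → x ∈ (canonical X).U c →
    H'.β.f PUnit.unit a c x * f a i x = H.β.f PUnit.unit i c x

/-- The frame `e ⊗ f - f ⊗ e`, `e ⊗ e`, `e ⊗ f + f ⊗ e`, `f ⊗ f` of `V ⊗ V`, in terms of
`e ⊗ e`, `e ⊗ f`, `f ⊗ e`, `f ⊗ f`: the decomposition `Λ² V ⊕ Sym² V = V ⊗ V`. -/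
def frameMat : Matrix (Fin 4) (Fin 4) ℂ :=
  !![0, 1, 0, 0; 1, 0, 1, 0; -1, 0, 1, 0; 0, 0, 0, 1]

end Isomorphisms

section StiefelWhitney

variable {X : Type u} [TopologicalSpace X]

/-- A Čech 2-cocycle with coefficients in the constant sheaf `ℤ/2`. -/
structure Cech2Cocycle (C : Cover X) where
  c : C.ι → C.ι → C.ι → X → ZMod 2
  continuousOn : ∀ i j k, ContinuousOn (c i j k) (C.U i ∩ C.U j ∩ C.U k)
  cocycle : ∀ i j k l x, x ∈ C.U i → x ∈ C.U j → x ∈ C.U k → x ∈ C.U l →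
    c j k l x - c i k l x + c i j l x - c i j k x = 0

/-- The class of a 2-cocycle in `Ȟ²(X, ℤ/2)`, the direct limit over refinements of covers, is zero:
on some refinement the cocycle is a coboundary. -/
def Cech2Cocycle.IsZero {C : Cover X} (c : Cech2Cocycle C) : Prop :=
  ∃ (D : Cover X) (r : D.ι → C.ι) (η : D.ι → D.ι → X → ZMod 2),
    (∀ i, D.U i ⊆ C.U (r i)) ∧
    (∀ i j, ContinuousOn (η i j) (D.U i ∩ D.U j)) ∧
    ∀ i j k x, x ∈ D.U i → x ∈ D.U j → x ∈ D.U k →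
      c.c (r i) (r j) (r k) x = η j k x - η i k x + η i j x

variable [ChartedSpace ℂ X]

/-- Holomorphic oriented orthogonal frames of `W` (isometric to the standard model `(Sym² ℂ², q₃)`) over a
cover, together with lifts of their transition functions `U i ∩ U j → SO(3, ℂ)` along the double
covering `Sym² : Spin(3, ℂ) = SL(2, ℂ) → SO(3, ℂ)`. -/
structure SpinLifting (W : SOBundle X 3) extends Cover X where
  r : ι → W.ι
  subset : ∀ i, U i ⊆ W.U (r i)
  h : ι → X → Matrix (Fin 3) (Fin 3) ℂ
  h_hol : ∀ i, HolMat (h i) (U i)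
  isometry : ∀ i, ∀ x ∈ U i, (h i x)ᵀ * W.q (r i) x * h i x = q₃
  orient : ∀ i, ∀ x ∈ U i, (h i x).det * W.δ (r i) x = -(Real.sqrt 2 : ℂ)
  lift : ι → ι → X → Matrix (Fin 2) (Fin 2) ℂ
  lift_continuousOn : ∀ i j, ContinuousOn (lift i j) (U i ∩ U j)
  det_lift : ∀ i j x, x ∈ U i → x ∈ U j → (lift i j x).det = 1
  lift_eq : ∀ i j x, x ∈ U i → x ∈ U j →
    h i x * sym2Mat (lift i j x) = W.g (r i) (r j) x * h j x

/-- The obstruction cocycle of a family of lifts: `lift i j * lift j k = (-1) ^ c i j k * lift i k`.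
Its class in `Ȟ²(X, ℤ/2)` is the second Stiefel-Whitney class of `W`. -/
def SpinLifting.IsObstruction {W : SOBundle X 3} (S : SpinLifting W)
    (c : Cech2Cocycle S.toCover) : Prop :=
  ∀ i j k x, x ∈ S.U i → x ∈ S.U j → x ∈ S.U k →
    S.lift i j x * S.lift j k x = (-1 : ℂ) ^ (c.c i j k x).val • S.lift i k x

/-- `w₂(W) = 0`. -/
def SOBundle.W2EqZero (W : SOBundle X 3) : Prop :=
  ∃ (S : SpinLifting W) (c : Cech2Cocycle S.toCover), S.IsObstruction c ∧ c.IsZero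

end StiefelWhitney

section Degree

variable {X : Type u} [TopologicalSpace X] [ChartedSpace ℂ X]

/-- A smooth Hermitian metric on a line bundle; `h i` is the squared norm of the `i`-th frame. -/
structure HermitianMetric (L : HolVB X 1) where
  h : L.ι → X → ℝ
  pos : ∀ i, ∀ x ∈ L.U i, 0 < h i x
  smooth : ∀ i, ContMDiffOn 𝓘(ℝ, ℂ) 𝓘(ℝ, ℝ) ∞ (h i) (L.U i)
  compat : ∀ i j x, x ∈ L.U i → x ∈ L.U j → h j x = ‖L.g i j x 0 0‖ ^ 2 * h i x

/-- The density, with respect to `dx dy` in the chart `c = x + iy`, of the first Chern form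
`(i / 2π) Θ = (i / 2π) ∂̄∂ log h = -(1 / 4π) Δ(log h) dx ∧ dy` of a Hermitian metric. -/
def HermitianMetric.chernDensity {L : HolVB X 1} (m : HermitianMetric L)
    (c : OpenPartialHomeomorph X ℂ) (z : ℂ) : ℝ :=
  -(1 / (4 * Real.pi)) * Laplacian.laplacian
    (fun w => Real.log (m.h (L.exists_mem (c.symm z)).choose (c.symm w))) z

/-- A finite partition of `X` into Borel sets, each with closure in a chart domain. -/
structure ChartPartition (X : Type u) [TopologicalSpace X] [ChartedSpace ℂ X] where
  n : ℕ
  c : Fin n → OpenPartialHomeomorph X ℂ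
  c_mem : ∀ k, c k ∈ atlas ℂ X
  A : Fin n → Set X
  closure_subset : ∀ k, closure (A k) ⊆ (c k).source
  measurable : ∀ k, MeasurableSet (c k '' A k)
  disjoint : ∀ k l, k ≠ l → Disjoint (A k) (A l)
  iUnion : ⋃ k, A k = Set.univ

/-- `deg L = d`, the degree being the integral over `X` of the first Chern form of a Hermitian
metric. -/
def HasDegree (L : HolVB X 1) (d : ℝ) : Prop :=
  ∃ (P : ChartPartition X) (m : HermitianMetric L),
    d = ∑ k, ∫ z in P.c k '' P.A k, m.chernDensity (P.c k) z

end Degree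

section Moduli

variable {X : Type u} [TopologicalSpace X] [ChartedSpace ℂ X] [IsManifold 𝓘(ℂ) ω X]

/-- `(V, φ)` is semistable: every `φ`-invariant line subbundle `L ⊆ V` has degree `≤ 0`. -/
def SL2Higgs.IsSemistable (H : SL2Higgs X) : Prop :=
  ∀ (L : HolVB X 1) (s : VBHom L H.toHolVB),
    (∀ i l x, x ∈ H.U i → x ∈ L.U l → s.f i l x ≠ 0) →
    (∀ i l c x, x ∈ H.U i → x ∈ L.U l → x ∈ (canonical X).U c →
      ∃ k : ℂ, H.φ.f i i c x * s.f i l x = k • s.f i l x) →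
    ∀ d, HasDegree L d → d ≤ 0

/-- `(W, β)` is semistable: every isotropic line subbundle `N ⊆ W` with `β(N) = 0` has
degree `≤ 0`. -/
def SO13Higgs.IsSemistable (H : SO13Higgs X) : Prop :=
  ∀ (N : HolVB X 1) (s : VBHom N H.toHolVB),
    (∀ i l x, x ∈ H.U i → x ∈ N.U l → s.f i l x ≠ 0) →
    (∀ i l x, x ∈ H.U i → x ∈ N.U l → (s.f i l x)ᵀ * H.q i x * s.f i l x = 0) →
    (∀ i l c x, x ∈ H.U i → x ∈ N.U l → x ∈ (canonical X).U c →
      H.β.f PUnit.unit i c x * s.f i l x = 0) →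
    ∀ d, HasDegree N d → d ≤ 0

/-- The first vectors of the local frames span a `φ`-invariant line subbundle `L ⊆ V`. -/
def SL2Higgs.IsTriangular (H : SL2Higgs X) : Prop :=
  (∀ i j x, x ∈ H.U i → x ∈ H.U j → H.g i j x 1 0 = 0) ∧
  ∀ i c x, x ∈ H.U i → x ∈ (canonical X).U c → H.φ.f i i c x 1 0 = 0

/-- The first vectors of the local frames span an isotropic line subbundle `N ⊆ W` with
`β(N) = 0`, and the first two span `N^⊥`. -/
def SO13Higgs.IsTriangular (H : SO13Higgs X) : Prop :=
  (∀ i j x, x ∈ H.U i → x ∈ H.U j →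
    H.g i j x 1 0 = 0 ∧ H.g i j x 2 0 = 0 ∧ H.g i j x 2 1 = 0) ∧
  (∀ i, ∀ x ∈ H.U i, H.q i x 0 0 = 0 ∧ H.q i x 0 1 = 0) ∧
  ∀ i c x, x ∈ H.U i → x ∈ (canonical X).U c → H.β.f PUnit.unit i c x 0 0 = 0

theorem SL2Higgs.IsTriangular.phi {H : SL2Higgs X} (h : H.IsTriangular) {a i : H.ι}
    {c : (canonical X).ι} {x : X} (ha : x ∈ H.U a) (hi : x ∈ H.U i) (hc : x ∈ (canonical X).U c) :
    H.φ.f a i c x 1 0 = 0 := by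
  rw [H.φ.compat i a i i c c x hi ha hi hi hc hc]
  simp [Matrix.mul_apply, Fin.sum_univ_succ, h.1 a i x ha hi, h.1 i i x hi hi, h.2 i c x hi hc]

/-- The associated graded `(L ⊕ V/L, gr φ)`. -/
def SL2Higgs.gr (H : SL2Higgs X) (h : H.IsTriangular) : SL2Higgs X where
  toCover := H.toCover
  g i j x := Matrix.diagonal fun r => H.g i j x r r
  hol i j r t := by
    by_cases hrt : r = t
    · subst hrt
      simpa using H.hol i j r r
    · simpa [hrt] using holOn_const _ _
  g_self i x hi := by
    ext r t
    simp [H.g_self i x hi, Matrix.diagonal_apply, Matrix.one_apply]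
  g_comp i j k x hi hj hk := by
    rw [Matrix.diagonal_mul_diagonal, ← H.g_comp i j k x hi hj hk]
    congr 1
    funext r
    fin_cases r <;> simp [Matrix.mul_apply, Fin.sum_univ_succ, h.1 i j x hi hj, h.1 j k x hj hk]
  det_g i j x hi hj := by
    have := H.det_g i j x hi hj
    rw [Matrix.det_fin_two, h.1 i j x hi hj] at this
    simpa [Fin.prod_univ_two] using this
  φ :=
    { f := fun a i c x => Matrix.diagonal fun r => H.φ.f a i c x r r
      hol := by
        intro a i c r t
        by_cases hrt : r = t
        · subst hrt
          simpa using H.φ.hol a i c r r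
        · simpa [hrt] using holOn_const _ _
      compat := by
        intro a b i j c d x ha hb hi hj hc hd
        simp only [Matrix.diagonal_mul_diagonal]
        rw [H.φ.compat a b i j c d x ha hb hi hj hc hd]
        ext r t
        fin_cases r <;> fin_cases t <;>
          simp [Matrix.mul_apply, Fin.sum_univ_succ, h.1 b a x hb ha, h.1 i j x hi hj,
            h.phi ha hi hc] }
  trace_φ i c x hi hc := by
    simpa [Matrix.trace_fin_two] using H.trace_φ i c x hi hc

/-- The associated graded `(N ⊕ N^⊥/N ⊕ W/N^⊥, gr β)`. -/
def SO13Higgs.gr (H : SO13Higgs X) (h : H.IsTriangular) : SO13Higgs X where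
  toCover := H.toCover
  g i j x := Matrix.diagonal fun r => H.g i j x r r
  hol i j r t := by
    by_cases hrt : r = t
    · subst hrt
      simpa using H.hol i j r r
    · simpa [hrt] using holOn_const _ _
  g_self i x hi := by
    ext r t
    simp [H.g_self i x hi, Matrix.diagonal_apply, Matrix.one_apply]
  g_comp i j k x hi hj hk := by
    rw [Matrix.diagonal_mul_diagonal, ← H.g_comp i j k x hi hj hk]
    congr 1
    funext r
    obtain ⟨a1, a2, a3⟩ := h.1 i j x hi hj
    obtain ⟨b1, b2, b3⟩ := h.1 j k x hj hk
    fin_cases r <;> simp [Matrix.mul_apply, Fin.sum_univ_succ, a1, a2, a3, b1, b2, b3]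
  q i x := !![0, 0, H.q i x 0 2; 0, H.q i x 1 1, 0; H.q i x 2 0, 0, 0]
  q_hol i r t := by
    fin_cases r <;> fin_cases t <;>
      first
        | exact holOn_const 0 _
        | exact H.q_hol i _ _
  q_symm i x hi := by
    have hs := fun r t => congrFun (congrFun (H.q_symm i x hi) r) t
    simp only [Matrix.transpose_apply] at hs
    ext r t
    fin_cases r <;> fin_cases t <;> simp [hs]
  q_compat i j x hi hj := by
    obtain ⟨a1, a2, a3⟩ := h.1 i j x hi hj
    obtain ⟨b1, b2⟩ := h.2.1 i x hi
    have hs := fun r t => congrFun (congrFun (H.q_symm i x hi) r) t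
    simp only [Matrix.transpose_apply] at hs
    have b3 : H.q i x 1 0 = 0 := by rw [← hs]; exact b2
    rw [H.q_compat i j x hi hj]
    ext r t
    fin_cases r <;> fin_cases t <;>
      simp [Matrix.mul_apply, Fin.sum_univ_succ, Matrix.diagonal_apply, a1, a2, a3, b1, b2, b3]
  δ := H.δ
  δ_hol := H.δ_hol
  δ_compat i j x hi hj := by
    obtain ⟨a1, a2, a3⟩ := h.1 i j x hi hj
    rw [H.δ_compat i j x hi hj, Matrix.det_diagonal, Matrix.det_fin_three, a1, a2, a3,
      Fin.prod_univ_three]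
    ring
  δ_sq i x hi := by
    obtain ⟨b1, b2⟩ := h.2.1 i x hi
    have hs := fun r t => congrFun (congrFun (H.q_symm i x hi) r) t
    simp only [Matrix.transpose_apply] at hs
    have b3 : H.q i x 1 0 = 0 := by rw [← hs]; exact b2
    rw [H.δ_sq i x hi, Matrix.det_fin_three, Matrix.det_fin_three, b1, b2, b3]
    simp
  δ_ne_zero := H.δ_ne_zero
  β :=
    { f := fun a i c x => !![0, H.β.f a i c x 0 1, 0]
      hol := by
        intro a i c r t
        fin_cases r
        fin_cases t
        · exact holOn_const 0 _
        · exact H.β.hol a i c _ _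
        · exact holOn_const 0 _
      compat := by
        rintro ⟨⟩ ⟨⟩ i j c d x ha hb hi hj hc hd
        obtain ⟨a1, a2, a3⟩ := h.1 i j x hi hj
        have hb := h.2.2 i c x hi hc
        rw [H.beta_compat hi hj hc hd]
        ext r t
        fin_cases r
        fin_cases t <;>
          simp [HolVB.trivial, Matrix.mul_apply, Fin.sum_univ_succ, Matrix.vecMul_diagonal,
            a3, hb, mul_comm] }

variable (X)

/-- The moduli space of `SL(2, ℂ)`-Higgs bundles (as a set): semistable Higgs bundles up to
S-equivalence, the equivalence relation generated by isomorphisms and by passing to the associated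
graded of an invariant line subbundle of degree zero. (The degree is zero as soon as the Higgs
bundle and its associated graded are both semistable.) -/
def ModuliSL2 : Type (u + 1) :=
  Quot fun H H' : {H : SL2Higgs X // H.IsSemistable} =>
    Nonempty (SL2Higgs.Iso H.1 H'.1) ∨
      ∃ h : H.1.IsTriangular, Nonempty (SL2Higgs.Iso (H.1.gr h) H'.1)

/-- The moduli space of `SO₀(1, 3)`-Higgs bundles (as a set): semistable Higgs bundles up to
S-equivalence, the equivalence relation generated by isomorphisms and by passing to the associated
graded of an isotropic line subbundle `N` of degree zero with `β(N) = 0`. -/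
def ModuliSO13 : Type (u + 1) :=
  Quot fun H H' : {H : SO13Higgs X // H.IsSemistable} =>
    Nonempty (SO13Higgs.Iso H.1 H'.1) ∨
      ∃ h : H.1.IsTriangular, Nonempty (SO13Higgs.Iso (H.1.gr h) H'.1)

variable {X}

/-- The point of the moduli space represented by a semistable Higgs bundle. -/
def ModuliSL2.mk (H : SL2Higgs X) (h : H.IsSemistable) : ModuliSL2 X := Quot.mk _ ⟨H, h⟩

/-- The point of the moduli space represented by a semistable Higgs bundle. -/
def ModuliSO13.mk (H : SO13Higgs X) (h : H.IsSemistable) : ModuliSO13 X := Quot.mk _ ⟨H, h⟩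

variable (X)

/-- The part `ℳ⁺` of the moduli space of `SO₀(1, 3)`-Higgs bundles where `w₂(W) = 0`. -/
def ModuliSO13Plus : Set (ModuliSO13 X) :=
  {p | ∃ (H : SO13Higgs X) (h : H.IsSemistable), H.W2EqZero ∧ ModuliSO13.mk H h = p}

end Moduli

end Higgs

end

/-!
The theorem rests on the double covering `Sym² : SL(2, ℂ) → SO(3, ℂ)` and on the identification of
`sl(2, ℂ)` with the dual of `Sym² ℂ²` given by `β(v ⊗ v) = ω(φ v, v)`.

For an `SL(2, ℂ)`-Higgs bundle, the constant change of basis `frameMat` intertwines `g ⊗ g` with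
`1 ⊕ Sym² g` and `φ ⊗ 1 - 1 ⊗ φ` with the block matrix built from `β`
(`tensorMat_mul_frameMat`, `tensorMat_sub_mul_frameMat`), so it glues to the isomorphism
`SL2Higgs.isogenyIso`.

Conversely, let `w₂(W) = 0`. The lifts to `SL(2, ℂ)` of the transition functions of `W` multiply up
to signs, and these signs form a coboundary on a finer cover; correcting the lifts by the bounding
cochain gives a cocycle. It is holomorphic because continuous lifts of holomorphic maps along
`Sym²` are holomorphic (`holMat_of_sym2Mat`). As `β` determines a trace-free `φ` uniquely, the
local Higgs fields glue (`SL2Bundle.higgsOfLocal`), which gives `SO13Higgs.exists_sym2_iso`.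

For semistability, the squaring map identifies the lines of `V` with the isotropic lines of
`Sym² V`, and `φ`-invariant lines with those on which `β` vanishes. Every isotropic line subbundle
`N` of `Sym² V` is thus the square of a line subbundle `L` of `V` (`rootFrames`). A Hermitian metric
on either of them induces one on the other, whose Chern form is doubled or halved because the
logarithm of the absolute value of a nowhere zero holomorphic function is harmonic
(`HermitianMetric.chernDensity_eq_mul`); hence `deg N = 2 deg L`. So `(V, φ)` and `(Sym² V, β)` are
semistable together, and since `Sym²` commutes with isomorphisms and with associated gradeds, it
descends to the moduli spaces, with image given by the converse above.
-/

noncomputable section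

namespace Higgs

/-! ### Holomorphic functions and smooth functions in charts -/

section HolomorphicFunctions

variable {X : Type u} [TopologicalSpace X] [ChartedSpace ℂ X]

theorem HolOn.continuousOn {f : X → ℂ} {s : Set X} (h : HolOn f s) : ContinuousOn f s :=
  MDifferentiableOn.continuousOn h

theorem HolOn.sum {ι : Type*} {t : Finset ι} {f : ι → X → ℂ} {s : Set X}
    (h : ∀ k ∈ t, HolOn (f k) s) : HolOn (fun x => ∑ k ∈ t, f k x) s := by
  classical
  induction t using Finset.induction_on with
  | empty => simpa using holOn_const 0 s
  | insert a t ha ih =>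
    simp only [Finset.sum_insert ha]
    exact (h a (Finset.mem_insert_self a t)).add
      (ih fun k hk => h k (Finset.mem_insert_of_mem hk))

theorem HolMat.mul {l m n : ℕ} {A : X → Matrix (Fin l) (Fin m) ℂ}
    {B : X → Matrix (Fin m) (Fin n) ℂ} {s : Set X} (hA : HolMat A s) (hB : HolMat B s) :
    HolMat (fun x => A x * B x) s := by
  intro r t
  simp only [Matrix.mul_apply]
  exact HolOn.sum fun k _ => (hA r k).mul (hB k t)

theorem HolMat.transpose {m n : ℕ} {A : X → Matrix (Fin m) (Fin n) ℂ} {s : Set X}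
    (hA : HolMat A s) : HolMat (fun x => (A x)ᵀ) s := fun r t => hA t r

theorem holMat_const {m n : ℕ} (A : Matrix (Fin m) (Fin n) ℂ) (s : Set X) :
    HolMat (fun _ => A) s := fun _ _ => holOn_const _ _

theorem HolMat.congr {m n : ℕ} {A B : X → Matrix (Fin m) (Fin n) ℂ} {s : Set X}
    (hA : HolMat A s) (h : ∀ x ∈ s, B x = A x) : HolMat B s :=
  fun r t => (hA r t).congr fun x hx => by rw [h x hx]

theorem HolMat.continuousOn {m n : ℕ} {A : X → Matrix (Fin m) (Fin n) ℂ} {s : Set X}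
    (hA : HolMat A s) : ContinuousOn A s :=
  continuousOn_pi.2 fun r => continuousOn_pi.2 fun t => (hA r t).continuousOn

theorem holOn_of_forall_nhds {f : X → ℂ} {s : Set X}
    (h : ∀ x ∈ s, ∃ t ∈ 𝓝 x, HolOn f t) : HolOn f s := fun x hx => by
  obtain ⟨t, ht, hf⟩ := h x hx
  exact ((hf x (mem_of_mem_nhds ht)).mdifferentiableAt ht).mdifferentiableWithinAt

/-- A continuous square root of a holomorphic function is holomorphic where it does not vanish:
near a point `x` it is `f x` times the principal square root of `f ^ 2 / f x ^ 2`. -/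
theorem HolOn.of_mul_self {f : X → ℂ} {s : Set X} (hs : IsOpen s) (hc : ContinuousOn f s)
    (h2 : HolOn (fun x => f x * f x) s) (h0 : ∀ x ∈ s, f x ≠ 0) : HolOn f s := by
  intro x hx
  have hx0 := h0 x hx
  have hev : ∀ᶠ y in 𝓝 x, f y = f x * ((f x * f x)⁻¹ * (f y * f y)) ^ (2⁻¹ : ℂ) := by
    have hca : ContinuousAt (fun y => ((f x)⁻¹ * f y).re) x :=
      Complex.continuous_re.continuousAt.comp
        (continuousAt_const.mul (hc.continuousAt (hs.mem_nhds hx)))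
    have hpos : ∀ᶠ y in 𝓝 x, 0 < ((f x)⁻¹ * f y).re :=
      hca.eventually (lt_mem_nhds (by simp [hx0]))
    filter_upwards [hpos] with y hy
    have := Complex.sq_cpow_two_inv hy
    have e : (f x * f x)⁻¹ * (f y * f y) = ((f x)⁻¹ * f y) ^ 2 := by
      rw [mul_inv]; ring
    rw [e, this]
    field_simp
  have hd : MDifferentiableAt 𝓘(ℂ) 𝓘(ℂ) (fun y => f y * f y) x :=
    (h2 x hx).mdifferentiableAt (hs.mem_nhds hx)
  have hroot : DifferentiableAt ℂ (fun w : ℂ => f x * ((f x * f x)⁻¹ * w) ^ (2⁻¹ : ℂ))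
      (f x * f x) := by
    refine (differentiableAt_const _).mul
      (((differentiableAt_const _).mul differentiableAt_id).cpow (differentiableAt_const _) ?_)
    simp only [Pi.mul_apply, inv_mul_cancel₀ (mul_ne_zero hx0 hx0)]
    exact Complex.one_mem_slitPlane
  have hcomp : MDifferentiableAt 𝓘(ℂ) 𝓘(ℂ)
      (fun y => f x * ((f x * f x)⁻¹ * (f y * f y)) ^ (2⁻¹ : ℂ)) x :=
    MDifferentiableAt.comp x (g := fun w : ℂ => f x * ((f x * f x)⁻¹ * w) ^ (2⁻¹ : ℂ))
      hroot.mdifferentiableAt hd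
  exact (hcomp.congr_of_eventuallyEq hev).mdifferentiableWithinAt

variable [IsManifold 𝓘(ℂ) ω X]

theorem HolOn.differentiableOn_chart {f : X → ℂ} {s : Set X} (hf : HolOn f s)
    {c : OpenPartialHomeomorph X ℂ} (hc : c ∈ atlas ℂ X) :
    DifferentiableOn ℂ (fun z => f (c.symm z)) (c.target ∩ c.symm ⁻¹' s) := by
  have hman : IsManifold 𝓘(ℂ) 1 X := IsManifold.of_le (n := ω) le_top
  have h1 : MDifferentiableOn 𝓘(ℂ) 𝓘(ℂ) c.symm c.target := mdifferentiableOn_atlas_symm hc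
  exact (MDifferentiableOn.comp hf (h1.mono Set.inter_subset_left)
    fun z hz => hz.2).differentiableOn

/-- The real surface underlying a Riemann surface is a smooth manifold. -/
theorem isManifold_real : IsManifold 𝓘(ℝ, ℂ) ∞ X := by
  refine isManifold_of_contDiffOn _ _ _ fun c c' hc hc' => ?_
  have h := ((differentiableOn_transition X hc hc').contDiffOn (n := ∞)
    (c.symm.trans c').open_source).restrict_scalars ℝ
  simpa [Function.comp_def] using h

theorem HolOn.contMDiffOn {f : X → ℂ} {s : Set X} (hs : IsOpen s) (hf : HolOn f s) :
    ContMDiffOn 𝓘(ℝ, ℂ) 𝓘(ℝ, ℂ) ∞ f s := by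
  have hman := isManifold_real (X := X)
  refine contMDiffOn_of_locally_contMDiffOn fun x hx =>
    ⟨(chartAt ℂ x).source, (chartAt ℂ x).open_source, mem_chart_source ℂ x, ?_⟩
  have h1 := (((hf.differentiableOn_chart (chart_mem_atlas ℂ x)).contDiffOn (n := ∞)
    ((chartAt ℂ x).isOpen_inter_preimage_symm hs)).restrict_scalars ℝ).contMDiffOn
  have h2 : ContMDiffOn 𝓘(ℝ, ℂ) 𝓘(ℝ, ℂ) ∞ (chartAt ℂ x) (chartAt ℂ x).source :=
    contMDiffOn_of_mem_maximalAtlas (IsManifold.chart_mem_maximalAtlas x)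
  refine (h1.comp (h2.mono Set.inter_subset_right) ?_).congr ?_
  · intro y hy
    exact ⟨(chartAt ℂ x).map_source hy.2, by simp [(chartAt ℂ x).left_inv hy.2, hy.1]⟩
  · intro y hy
    simp [(chartAt ℂ x).left_inv hy.2]

end HolomorphicFunctions

/-! ### Degrees of line bundles with comparable Hermitian metrics -/

section Degrees

variable {X : Type u} [TopologicalSpace X] [ChartedSpace ℂ X] [IsManifold 𝓘(ℂ) ω X]

theorem HermitianMetric.contDiffAt_log_chart {L : HolVB X 1} (m : HermitianMetric L) (i : L.ι)
    {c : OpenPartialHomeomorph X ℂ} (hc : c ∈ atlas ℂ X) {z : ℂ} (hz : z ∈ c.target)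
    (hi : c.symm z ∈ L.U i) :
    ContDiffAt ℝ 2 (fun w => Real.log (m.h i (c.symm w))) z := by
  have hman := isManifold_real (X := X)
  have h1 : ContMDiffOn 𝓘(ℝ, ℂ) 𝓘(ℝ, ℂ) ∞ c.symm c.target :=
    contMDiffOn_symm_of_mem_maximalAtlas (IsManifold.subset_maximalAtlas hc)
  have h2 : ContDiffOn ℝ ∞ (fun w => m.h i (c.symm w)) (c.target ∩ c.symm ⁻¹' L.U i) :=
    contMDiffOn_iff_contDiffOn.1 ((m.smooth i).comp (h1.mono Set.inter_subset_left)
      fun z hz => hz.2)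
  have h3 := h2.contDiffAt ((c.isOpen_inter_preimage_symm (L.isOpen i)).mem_nhds ⟨hz, hi⟩)
  exact (h3.of_le (by norm_cast)).log (m.pos i _ hi).ne'

/-- If, in all local frames, `log h_L` is `k log h_N` plus the logarithm of the absolute value of a
nowhere zero holomorphic function, then the Chern density of `h_L` is `k` times that of `h_N`,
since the extra term is harmonic. -/
theorem HermitianMetric.chernDensity_eq_mul {L N : HolVB X 1} (mL : HermitianMetric L)
    (mN : HermitianMetric N) (k : ℝ) (u : L.ι → N.ι → X → ℂ)
    (hu : ∀ l n, HolOn (u l n) (L.U l ∩ N.U n))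
    (hu0 : ∀ l n x, x ∈ L.U l → x ∈ N.U n → u l n x ≠ 0)
    (h : ∀ l n x, x ∈ L.U l → x ∈ N.U n →
      Real.log (mL.h l x) = Real.log ‖u l n x‖ + k * Real.log (mN.h n x))
    {c : OpenPartialHomeomorph X ℂ} (hc : c ∈ atlas ℂ X) {z : ℂ} (hz : z ∈ c.target) :
    mL.chernDensity c z = k * mN.chernDensity c z := by
  have hlL := (L.exists_mem (c.symm z)).choose_spec
  have hnN := (N.exists_mem (c.symm z)).choose_spec
  unfold HermitianMetric.chernDensity
  set l := (L.exists_mem (c.symm z)).choose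
  set n := (N.exists_mem (c.symm z)).choose
  have hopen : IsOpen (c.target ∩ c.symm ⁻¹' (L.U l ∩ N.U n)) :=
    c.isOpen_inter_preimage_symm ((L.isOpen l).inter (N.isOpen n))
  have hmem : c.target ∩ c.symm ⁻¹' (L.U l ∩ N.U n) ∈ 𝓝 z :=
    hopen.mem_nhds ⟨hz, hlL, hnN⟩
  have hev : (fun w => Real.log (mL.h l (c.symm w))) =ᶠ[𝓝 z]
      (fun w => Real.log ‖u l n (c.symm w)‖) + k • fun w => Real.log (mN.h n (c.symm w)) := by
    filter_upwards [hmem] with w hw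
    simpa using h l n _ hw.2.1 hw.2.2
  have hharm : InnerProductSpace.HarmonicAt (fun w => Real.log ‖u l n (c.symm w)‖) z :=
    AnalyticAt.harmonicAt_log_norm
      (((hu l n).differentiableOn_chart hc).analyticAt hmem) (hu0 l n _ hlL hnN)
  have hN := mN.contDiffAt_log_chart n hc hz hnN
  rw [(InnerProductSpace.laplacian_congr_nhds hev).eq_of_nhds,
    ContDiffAt.laplacian_add (f₂ := k • _) hharm.1 (hN.const_smul k), hharm.2.eq_of_nhds,
    InnerProductSpace.laplacian_smul k hN]
  simp
  ring

/-- Comparable metrics as in `HermitianMetric.chernDensity_eq_mul` give proportional degrees. -/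
theorem HasDegree.of_metric {L N : HolVB X 1} {d k : ℝ} (hd : HasDegree N d)
    (H : ∀ mN : HermitianMetric N, ∃ (mL : HermitianMetric L) (u : L.ι → N.ι → X → ℂ),
      (∀ l n, HolOn (u l n) (L.U l ∩ N.U n)) ∧
      (∀ l n x, x ∈ L.U l → x ∈ N.U n → u l n x ≠ 0) ∧
      ∀ l n x, x ∈ L.U l → x ∈ N.U n →
        Real.log (mL.h l x) = Real.log ‖u l n x‖ + k * Real.log (mN.h n x)) :
    HasDegree L (k * d) := by
  obtain ⟨P, mN, rfl⟩ := hd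
  obtain ⟨mL, u, h1, h2, h3⟩ := H mN
  refine ⟨P, mL, ?_⟩
  rw [Finset.mul_sum]
  refine Finset.sum_congr rfl fun j _ => ?_
  rw [← MeasureTheory.integral_const_mul]
  refine MeasureTheory.setIntegral_congr_fun (P.measurable j) ?_
  rintro _ ⟨x, hx, rfl⟩
  have hx' : x ∈ (P.c j).source := P.closure_subset j (subset_closure hx)
  exact (mL.chernDensity_eq_mul mN k u h1 h2 h3 (P.c_mem j) ((P.c j).map_source hx')).symm

end Degrees

/-! ### Linear algebra of `ℂ² ⊗ ℂ² = Λ² ℂ² ⊕ Sym² ℂ²` -/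

section LinearAlgebra

/-- The matrix of `A ⊗ B` on `ℂ² ⊗ ℂ²`, in the basis `e ⊗ e`, `e ⊗ f`, `f ⊗ e`, `f ⊗ f`. -/
def tensorMat (A B : Matrix (Fin 2) (Fin 2) ℂ) : Matrix (Fin (2 * 2)) (Fin (2 * 2)) ℂ :=
  Matrix.reindex finProdFinEquiv finProdFinEquiv (A ⊗ₖ B)

/-- The matrix with the four given blocks, for the decomposition `ℂ ⊕ ℂ³`. -/
def blockMat (A : Matrix (Fin 1) (Fin 1) ℂ) (B : Matrix (Fin 1) (Fin 3) ℂ)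
    (C : Matrix (Fin 3) (Fin 1) ℂ) (D : Matrix (Fin 3) (Fin 3) ℂ) :
    Matrix (Fin (1 + 3)) (Fin (1 + 3)) ℂ :=
  Matrix.reindex finSumFinEquiv finSumFinEquiv (Matrix.fromBlocks A B C D)

theorem tensorMat_mul (A B C D : Matrix (Fin 2) (Fin 2) ℂ) :
    tensorMat A B * tensorMat C D = tensorMat (A * C) (B * D) := by
  simp only [tensorMat, Matrix.reindex_apply, Matrix.submatrix_mul_equiv,
    ← Matrix.mul_kronecker_mul]

theorem tensorMat_one : tensorMat 1 1 = 1 := by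
  simp [tensorMat]

theorem tensorMat_transpose (A B : Matrix (Fin 2) (Fin 2) ℂ) :
    (tensorMat A B)ᵀ = tensorMat Aᵀ Bᵀ := by
  simp only [tensorMat, Matrix.reindex_apply, Matrix.transpose_submatrix,
    ← Matrix.kroneckerMap_transpose]

theorem det_tensorMat {A B : Matrix (Fin 2) (Fin 2) ℂ} (hA : A.det = 1) (hB : B.det = 1) :
    (tensorMat A B).det = 1 := by
  rw [tensorMat, Matrix.det_reindex_self, Matrix.det_kronecker, hA, hB]
  simp

theorem tensorMat_entries (A B : Matrix (Fin 2) (Fin 2) ℂ) :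
    tensorMat A B =
      !![A 0 0 * B 0 0, A 0 0 * B 0 1, A 0 1 * B 0 0, A 0 1 * B 0 1;
         A 0 0 * B 1 0, A 0 0 * B 1 1, A 0 1 * B 1 0, A 0 1 * B 1 1;
         A 1 0 * B 0 0, A 1 0 * B 0 1, A 1 1 * B 0 0, A 1 1 * B 0 1;
         A 1 0 * B 1 0, A 1 0 * B 1 1, A 1 1 * B 1 0, A 1 1 * B 1 1] := by
  ext r t
  fin_cases r <;> fin_cases t <;> rfl

theorem blockMat_entries (A : Matrix (Fin 1) (Fin 1) ℂ) (B : Matrix (Fin 1) (Fin 3) ℂ)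
    (C : Matrix (Fin 3) (Fin 1) ℂ) (D : Matrix (Fin 3) (Fin 3) ℂ) :
    blockMat A B C D =
      !![A 0 0, B 0 0, B 0 1, B 0 2;
         C 0 0, D 0 0, D 0 1, D 0 2;
         C 1 0, D 1 0, D 1 1, D 1 2;
         C 2 0, D 2 0, D 2 1, D 2 2] := by
  ext r t
  fin_cases r <;> fin_cases t <;> rfl

theorem det_frameMat : frameMat.det = -2 := by
  simp [frameMat, Matrix.det_succ_row_zero, Fin.sum_univ_succ, Fin.succAbove]
  norm_num

/-- `g ⊗ g` is the identity on `Λ² ℂ²` and `Sym² g` on `Sym² ℂ²`. -/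
theorem tensorMat_mul_frameMat {A : Matrix (Fin 2) (Fin 2) ℂ} (h : A.det = 1) :
    tensorMat A A * frameMat = frameMat * blockMat 1 0 0 (sym2Mat A) := by
  rw [Matrix.det_fin_two] at h
  rw [tensorMat_entries, blockMat_entries]
  ext r t
  fin_cases r <;> fin_cases t <;>
    simp [frameMat, sym2Mat, Matrix.mul_apply, Fin.sum_univ_succ] <;> grind

theorem frameMat_isometry :
    frameMatᵀ * tensorMat J J * frameMat = blockMat q₁ 0 0 q₃ := by
  rw [tensorMat_entries, blockMat_entries]
  ext r t
  fin_cases r <;> fin_cases t <;>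
    simp [frameMat, J, q₁, q₃, Matrix.mul_apply, Fin.sum_univ_succ] <;> norm_num

theorem inv_q₃ : q₃⁻¹ = !![0, 0, 1; 0, -(1 / 2), 0; 1, 0, 0] := by
  refine Matrix.inv_eq_right_inv ?_
  ext r t
  fin_cases r <;> fin_cases t <;> simp [q₃, Matrix.mul_apply, Fin.sum_univ_succ]

/-- `φ ⊗ 1 - 1 ⊗ φ` exchanges `Λ² ℂ²` and `Sym² ℂ²`, with off-diagonal blocks `β` and `-βᵀ`. -/
theorem tensorMat_sub_mul_frameMat {M : Matrix (Fin 2) (Fin 2) ℂ} (h : M.trace = 0) :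
    (tensorMat M 1 - tensorMat 1 M) * frameMat =
      frameMat * blockMat 0 (betaMat M) (-(q₃⁻¹ * (betaMat M)ᵀ * q₁)) 0 := by
  rw [Matrix.trace_fin_two] at h
  rw [tensorMat_entries, tensorMat_entries, blockMat_entries, inv_q₃]
  ext r t
  fin_cases r <;> fin_cases t <;>
    simp [frameMat, betaMat, q₁, Matrix.mul_apply, Fin.sum_univ_succ, Matrix.vecMul,
      dotProduct] <;> grind

/-- The trace-free matrix `[[a, b], [c, -a]]` with `[-c, 2a, b]` equal to the given row. -/
def phiMat (B : Matrix (Fin 1) (Fin 3) ℂ) : Matrix (Fin 2) (Fin 2) ℂ :=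
  !![B 0 1 / 2, B 0 2; -B 0 0, -(B 0 1 / 2)]

theorem betaMat_phiMat (B : Matrix (Fin 1) (Fin 3) ℂ) : betaMat (phiMat B) = B := by
  ext r t
  fin_cases r
  fin_cases t <;> simp [betaMat, phiMat]
  ring

theorem trace_phiMat (B : Matrix (Fin 1) (Fin 3) ℂ) : (phiMat B).trace = 0 := by
  simp [phiMat, Matrix.trace_fin_two]

theorem phiMat_betaMat {M : Matrix (Fin 2) (Fin 2) ℂ} (h : M.trace = 0) :
    phiMat (betaMat M) = M := by
  rw [Matrix.trace_fin_two] at h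
  ext r t
  fin_cases r <;> fin_cases t <;> simp [betaMat, phiMat]
  linear_combination -h

/-- The square `v ↦ v ⊗ v` from `ℂ²` to `Sym² ℂ²`. -/
def sqVec (v : Matrix (Fin 2) (Fin 1) ℂ) : Matrix (Fin 3) (Fin 1) ℂ :=
  !![v 0 0 ^ 2; v 0 0 * v 1 0; v 1 0 ^ 2]

theorem sqVec_mul (A : Matrix (Fin 2) (Fin 2) ℂ) (v : Matrix (Fin 2) (Fin 1) ℂ) :
    sqVec (A * v) = sym2Mat A * sqVec v := by
  ext r t
  fin_cases r <;> fin_cases t <;>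
    simp [sqVec, sym2Mat, Matrix.mul_apply, Fin.sum_univ_succ] <;> ring

theorem sqVec_smul (k : ℂ) (v : Matrix (Fin 2) (Fin 1) ℂ) :
    sqVec (k • v) = k ^ 2 • sqVec v := by
  ext r t
  fin_cases r <;> fin_cases t <;> simp [sqVec] <;> ring

theorem sqVec_ne_zero {v : Matrix (Fin 2) (Fin 1) ℂ} (hv : v ≠ 0) : sqVec v ≠ 0 := by
  intro h
  refine hv ?_
  have h0 := congrFun (congrFun h 0) 0
  have h2 := congrFun (congrFun h 2) 0
  simp [sqVec] at h0 h2
  ext r t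
  fin_cases r <;> fin_cases t <;> simp [h0, h2]

theorem sqVec_isotropic (v : Matrix (Fin 2) (Fin 1) ℂ) : (sqVec v)ᵀ * q₃ * sqVec v = 0 := by
  ext r t
  fin_cases r
  fin_cases t
  simp [sqVec, q₃, Matrix.mul_apply, Fin.sum_univ_succ]
  ring

theorem exists_eq_smul_of_det_eq_zero {v w : Matrix (Fin 2) (Fin 1) ℂ} (hv : v ≠ 0)
    (hdet : v 0 0 * w 1 0 - v 1 0 * w 0 0 = 0) : ∃ t : ℂ, w = t • v := by
  by_cases hv0 : v 0 0 = 0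
  · have hv1 : v 1 0 ≠ 0 := by
      intro hv1
      refine hv ?_
      ext r t
      fin_cases r <;> fin_cases t <;> simp [hv0, hv1]
    refine ⟨w 1 0 / v 1 0, ?_⟩
    ext r t
    fin_cases r <;> fin_cases t <;> simp <;> field_simp
    linear_combination -hdet
  · refine ⟨w 0 0 / v 0 0, ?_⟩
    ext r t
    fin_cases r <;> fin_cases t <;> simp <;> field_simp
    linear_combination hdet

/-- Points of the conic `ℙ(ℂ²) ⊆ ℙ(Sym² ℂ²)` determine lines in `ℂ²`. -/
theorem exists_eq_smul_of_sqVec {v w : Matrix (Fin 2) (Fin 1) ℂ} {k : ℂ} (hv : v ≠ 0)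
    (h : sqVec w = k • sqVec v) : ∃ t : ℂ, w = t • v := by
  have h0 := congrFun (congrFun h 0) 0
  have h1 := congrFun (congrFun h 1) 0
  have h2 := congrFun (congrFun h 2) 0
  simp [sqVec] at h0 h1 h2
  have hdet : v 0 0 * w 1 0 - v 1 0 * w 0 0 = 0 := by
    refine pow_eq_zero_iff (two_ne_zero) |>.1 ?_
    linear_combination v 0 0 ^ 2 * h2 - 2 * v 0 0 * v 1 0 * h1 + v 1 0 ^ 2 * h0
  exact exists_eq_smul_of_det_eq_zero hv hdet

/-- `β(v ⊗ v) = ω(φ v, v)`, which vanishes when `v` is an eigenvector of `φ`. -/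
theorem betaMat_mul_sqVec_of_eigenvector {M : Matrix (Fin 2) (Fin 2) ℂ}
    {v : Matrix (Fin 2) (Fin 1) ℂ} (hM : M.trace = 0) {k : ℂ} (h : M * v = k • v) :
    betaMat M * sqVec v = 0 := by
  rw [Matrix.trace_fin_two] at hM
  have h0 := congrFun (congrFun h 0) 0
  have h1 := congrFun (congrFun h 1) 0
  simp [Matrix.mul_apply, Fin.sum_univ_succ] at h0 h1
  ext r t
  fin_cases r
  fin_cases t
  simp [betaMat, sqVec, Matrix.mul_apply, Fin.sum_univ_succ]
  linear_combination v 1 0 * h0 - v 0 0 * h1 + v 0 0 * v 1 0 * hM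

/-- `β(v ⊗ v) = ω(φ v, v)` vanishes only when `v` is an eigenvector of `φ`. -/
theorem exists_eigenvalue_of_betaMat_mul_sqVec {M : Matrix (Fin 2) (Fin 2) ℂ}
    {v : Matrix (Fin 2) (Fin 1) ℂ} (hM : M.trace = 0) (hv : v ≠ 0)
    (h : betaMat M * sqVec v = 0) : ∃ k : ℂ, M * v = k • v := by
  rw [Matrix.trace_fin_two] at hM
  have h0 := congrFun (congrFun h 0) 0
  simp [betaMat, sqVec, Matrix.mul_apply, Fin.sum_univ_succ] at h0
  refine exists_eq_smul_of_det_eq_zero hv ?_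
  simp [Matrix.mul_apply, Fin.sum_univ_succ]
  linear_combination v 0 0 * v 1 0 * hM - h0

end LinearAlgebra

/-! ### The isogeny on `((V, φ), (V, -φ))` -/

section Isogeny

variable {X : Type u} [TopologicalSpace X] [ChartedSpace ℂ X]

theorem HolVB.g_mul_g_symm {n : ℕ} (E : HolVB X n) {i j : E.ι} {x : X} (hi : x ∈ E.U i)
    (hj : x ∈ E.U j) : E.g i j x * E.g j i x = 1 := by
  rw [E.g_comp _ _ _ x hi hj hi, E.g_self _ x hi]

theorem VBHom.eq_mul {m n : ℕ} {E : HolVB X m} {F : HolVB X n} (T : VBHom E F) {a b : F.ι}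
    {i : E.ι} {x : X} (ha : x ∈ F.U a) (hb : x ∈ F.U b) (hi : x ∈ E.U i) :
    T.f b i x = F.g b a x * T.f a i x := by
  rw [T.compat a b i i x ha hb hi hi, E.g_self _ x hi, Matrix.mul_one]

theorem VBHom.mul_eq {m n : ℕ} {E : HolVB X m} {F : HolVB X n} (T : VBHom E F) {a : F.ι}
    {i j : E.ι} {x : X} (ha : x ∈ F.U a) (hi : x ∈ E.U i) (hj : x ∈ E.U j) :
    T.f a j x = T.f a i x * E.g i j x := by
  rw [T.compat a a i j x ha ha hi hj, F.g_self _ x ha, Matrix.one_mul]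

variable [IsManifold 𝓘(ℂ) ω X]

theorem canonical_g_self {c : (canonical X).ι} {x : X} (hc : x ∈ (canonical X).U c) :
    (canonical X).g c c x 0 0 = 1 := by
  rw [(canonical X).g_self c x hc, Matrix.one_apply_eq]

theorem TwistedHom.mul_g {n : ℕ} {E : HolVB X n} (Φ : TwistedHom E E) {a i : E.ι}
    {c : (canonical X).ι} {x : X} (ha : x ∈ E.U a) (hi : x ∈ E.U i)
    (hc : x ∈ (canonical X).U c) : Φ.f a a c x * E.g a i x = E.g a i x * Φ.f i i c x := by
  rw [Φ.compat i a i a c c x hi ha hi ha hc hc, canonical_g_self hc, one_smul, mul_assoc,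
    E.g_mul_g_symm hi ha, mul_one]

theorem SO13Higgs.beta_mul_g (H : SO13Higgs X) {i j : H.ι} {c : (canonical X).ι} {x : X}
    (hi : x ∈ H.U i) (hj : x ∈ H.U j) (hc : x ∈ (canonical X).U c) :
    H.β.f PUnit.unit i c x * H.g i j x = H.β.f PUnit.unit j c x := by
  rw [H.beta_compat hi hj hc hc, canonical_g_self hc, one_smul]

/-- The isomorphism `𝒪 ⊕ Sym² V ≅ V ⊗ V` of `SO(4, ℂ)`-Higgs bundles, which in the frames of `V`
is the change of basis `frameMat`. -/
def SL2Higgs.isogenyIso (H : SL2Higgs X) : SOHiggs.Iso H.sym2.toSO4 (isogeny H H.neg) where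
  f p i x := tensorMat (H.g p.1 i.2 x) (H.g p.2 i.2 x) * frameMat
  hol p i := by
    refine HolMat.mul (fun r t => ?_) (holMat_const _ _)
    exact ((H.hol p.1 i.2 _ _).mono fun x hx => ⟨hx.1.1, hx.2.2⟩).mul
      ((H.hol p.2 i.2 _ _).mono fun x hx => ⟨hx.1.2, hx.2.2⟩)
  compat := by
    rintro ⟨a, a'⟩ ⟨b, b'⟩ ⟨_, i⟩ ⟨_, j⟩ x ⟨ha, ha'⟩ ⟨hb, hb'⟩ ⟨_, hi⟩ ⟨_, hj⟩
    change tensorMat (H.g b j x) (H.g b' j x) * frameMat =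
      tensorMat (H.g b a x) (H.g b' a' x) *
        (tensorMat (H.g a i x) (H.g a' i x) * frameMat) *
        blockMat 1 0 0 (sym2Mat (H.g i j x))
    rw [mul_assoc, mul_assoc, ← tensorMat_mul_frameMat (H.det_g i j x hi hj), ← mul_assoc,
      ← mul_assoc, tensorMat_mul, tensorMat_mul, H.g_comp b a i x hb ha hi,
      H.g_comp b' a' i x hb' ha' hi, H.g_comp b i j x hb hi hj, H.g_comp b' i j x hb' hi hj]
  isometry := by
    rintro ⟨a, a'⟩ ⟨_, i⟩ x ⟨ha, ha'⟩ ⟨_, hi⟩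
    change (tensorMat (H.g a i x) (H.g a' i x) * frameMat)ᵀ * tensorMat J J *
      (tensorMat (H.g a i x) (H.g a' i x) * frameMat) = blockMat q₁ 0 0 q₃
    rw [← frameMat_isometry, Matrix.transpose_mul, tensorMat_transpose]
    calc _ = frameMatᵀ * (tensorMat (H.g a i x)ᵀ (H.g a' i x)ᵀ * tensorMat J J *
          tensorMat (H.g a i x) (H.g a' i x)) * frameMat := by simp only [Matrix.mul_assoc]
      _ = _ := by
        rw [tensorMat_mul, tensorMat_mul, J_isometry (H.det_g a i x ha hi),
          J_isometry (H.det_g a' i x ha' hi)]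
  orient := by
    rintro ⟨a, a'⟩ ⟨_, i⟩ x ⟨ha, ha'⟩ ⟨_, hi⟩
    change (tensorMat (H.g a i x) (H.g a' i x) * frameMat).det * 1 =
      (Real.sqrt 2 : ℂ) * -(Real.sqrt 2 : ℂ)
    have h2 : (Real.sqrt 2 : ℂ) * (Real.sqrt 2 : ℂ) = 2 := by
      rw [← Complex.ofReal_mul, Real.mul_self_sqrt (by norm_num)]
      norm_num
    rw [Matrix.det_mul, det_tensorMat (H.det_g a i x ha hi) (H.det_g a' i x ha' hi),
      det_frameMat]
    linear_combination h2
  comm := by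
    rintro ⟨a, a'⟩ ⟨_, i⟩ c x ⟨ha, ha'⟩ ⟨_, hi⟩ hc
    change (tensorMat (H.φ.f a a c x) (H.g a' a' x) + tensorMat (H.g a a x)
        (-H.φ.f a' a' c x)) * (tensorMat (H.g a i x) (H.g a' i x) * frameMat) =
      tensorMat (H.g a i x) (H.g a' i x) * frameMat *
        blockMat 0 (betaMat (H.φ.f i i c x))
          (-(q₃⁻¹ * (betaMat (H.φ.f i i c x))ᵀ * q₁)) 0
    have hneg : ∀ A B : Matrix (Fin 2) (Fin 2) ℂ, tensorMat A (-B) = -tensorMat A B := by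
      intro A B
      ext r t
      simp [tensorMat]
    rw [mul_assoc (tensorMat (H.g a i x) (H.g a' i x)),
      ← tensorMat_sub_mul_frameMat (H.trace_φ i c x hi hc), ← mul_assoc, ← mul_assoc,
      add_mul, tensorMat_mul, tensorMat_mul, mul_sub, tensorMat_mul, tensorMat_mul,
      H.g_self a x ha, H.g_self a' x ha', H.φ.mul_g ha hi hc, neg_mul, H.φ.mul_g ha' hi hc,
      hneg]
    simp only [one_mul, mul_one, sub_eq_add_neg]

theorem SL2Higgs.isogenyIso_f (H : SL2Higgs X) (i : H.ι) {x : X} (hi : x ∈ H.U i) :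
    H.isogenyIso.f (i, i) (PUnit.unit, i) x = frameMat := by
  change tensorMat (H.g i i x) (H.g i i x) * frameMat = frameMat
  rw [H.g_self i x hi, tensorMat_one]
  exact one_mul _

end Isogeny

/-! ### Spin structures: from `SO₀(1, 3)`-Higgs bundles to `SL(2, ℂ)`-Higgs bundles -/

section Spin

variable {X : Type u} [TopologicalSpace X] [ChartedSpace ℂ X]

/-- The double covering `SL(2, ℂ) → SO(3, ℂ)` reflects holomorphy of continuous maps: the entries
of `Sym² A` and `det A = 1` determine all products of two entries of `A`, and locally one of the
entries of `A` is nowhere zero, hence a nowhere zero square root of a holomorphic function. -/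
theorem holMat_of_sym2Mat {A : X → Matrix (Fin 2) (Fin 2) ℂ} {s : Set X} (hs : IsOpen s)
    (hc : ContinuousOn A s) (hdet : ∀ x ∈ s, (A x).det = 1)
    (h : HolMat (fun x => sym2Mat (A x)) s) : HolMat A s := by
  have hprod : ∀ r t r' t', HolOn (fun x => A x r t * A x r' t') s := by
    have aa : HolOn (fun x => A x 0 0 * A x 0 0) s :=
      (h 0 0).congr fun x _ => by simp [sym2Mat, pow_two]
    have bb : HolOn (fun x => A x 0 1 * A x 0 1) s :=
      (h 0 2).congr fun x _ => by simp [sym2Mat, pow_two]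
    have cc : HolOn (fun x => A x 1 0 * A x 1 0) s :=
      (h 2 0).congr fun x _ => by simp [sym2Mat, pow_two]
    have dd : HolOn (fun x => A x 1 1 * A x 1 1) s :=
      (h 2 2).congr fun x _ => by simp [sym2Mat, pow_two]
    have ac : HolOn (fun x => A x 0 0 * A x 1 0) s := (h 1 0).congr fun x _ => by simp [sym2Mat]
    have bd : HolOn (fun x => A x 0 1 * A x 1 1) s := (h 1 2).congr fun x _ => by simp [sym2Mat]
    have ab : HolOn (fun x => A x 0 0 * A x 0 1) s :=
      ((holOn_const (1 / 2) s).mul (h 0 1)).congr fun x _ => by simp [sym2Mat]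
    have cd : HolOn (fun x => A x 1 0 * A x 1 1) s :=
      ((holOn_const (1 / 2) s).mul (h 2 1)).congr fun x _ => by simp [sym2Mat]
    have ad : HolOn (fun x => A x 0 0 * A x 1 1) s :=
      ((holOn_const (1 / 2) s).mul ((h 1 1).add (holOn_const 1 s))).congr fun x hx => by
        have := hdet x hx
        rw [Matrix.det_fin_two] at this
        simp only [sym2Mat, Matrix.of_apply, Matrix.cons_val]
        linear_combination (1 / 2) * this
    have bc : HolOn (fun x => A x 0 1 * A x 1 0) s :=
      (ad.sub (holOn_const 1 s)).congr fun x hx => by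
        have := hdet x hx
        rw [Matrix.det_fin_two] at this
        linear_combination -this
    have swap : ∀ {r t r' t'}, HolOn (fun x => A x r t * A x r' t') s →
        HolOn (fun x => A x r' t' * A x r t) s := fun h => h.congr fun x _ => mul_comm _ _
    intro r t r' t'
    fin_cases r <;> fin_cases t <;> fin_cases r' <;> fin_cases t' <;>
      first
        | assumption
        | exact swap (by assumption)
  intro r t
  refine holOn_of_forall_nhds fun x hx => ?_
  obtain ⟨r₀, t₀, h0⟩ : ∃ r₀ t₀, A x r₀ t₀ ≠ 0 := by
    by_contra! h0
    have := hdet x hx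
    simp [Matrix.det_fin_two, h0] at this
  have hentry : ContinuousOn (fun y => A y r₀ t₀) s :=
    continuousOn_pi.1 (continuousOn_pi.1 hc r₀) t₀
  have ho : IsOpen (s ∩ {y | A y r₀ t₀ ≠ 0}) :=
    hentry.isOpen_inter_preimage hs isOpen_ne
  refine ⟨_, ho.mem_nhds ⟨hx, h0⟩, ?_⟩
  have hroot : HolOn (fun y => A y r₀ t₀) (s ∩ {y | A y r₀ t₀ ≠ 0}) :=
    HolOn.of_mul_self ho (hentry.mono Set.inter_subset_left)
      ((hprod r₀ t₀ r₀ t₀).mono Set.inter_subset_left) fun y hy => hy.2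
  refine (((hprod r t r₀ t₀).mono Set.inter_subset_left).mul
    (hroot.inv fun y hy => hy.2)).congr fun y hy => ?_
  have : A y r₀ t₀ ≠ 0 := hy.2
  field_simp

theorem neg_one_pow_val_add (a b : ZMod 2) :
    (-1 : ℂ) ^ (a + b).val = (-1) ^ a.val * (-1) ^ b.val := by
  rw [ZMod.val_add, ← pow_add, neg_one_pow_eq_pow_mod_two (n := a.val + b.val)]

theorem sym2Mat_neg_one_pow_smul (n : ℕ) (A : Matrix (Fin 2) (Fin 2) ℂ) :
    sym2Mat ((-1 : ℂ) ^ n • A) = sym2Mat A := by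
  rcases neg_one_pow_eq_or ℂ n with h | h <;> rw [h]
  · rw [one_smul]
  · ext r t
    fin_cases r <;> fin_cases t <;> simp [sym2Mat]

theorem det_neg_one_pow_smul (n : ℕ) (A : Matrix (Fin 2) (Fin 2) ℂ) :
    ((-1 : ℂ) ^ n • A).det = A.det := by
  rw [Matrix.det_smul, Fintype.card_fin, ← pow_mul, mul_comm n 2, pow_mul]
  simp

theorem SpinLifting.sym2Mat_lift {W : SOBundle X 3} (S : SpinLifting W) {i j : S.ι} {x : X}
    (hi : x ∈ S.U i) (hj : x ∈ S.U j) :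
    sym2Mat (S.lift i j x) =
      q₃⁻¹ * ((S.h i x)ᵀ * W.q (S.r i) x * (W.g (S.r i) (S.r j) x * S.h j x)) := by
  have hu : IsUnit q₃.det := by rw [det_q₃]; exact isUnit_iff_ne_zero.2 two_ne_zero
  rw [← S.lift_eq i j x hi hj, ← Matrix.mul_assoc _ (S.h i x), S.isometry i x hi,
    ← Matrix.mul_assoc, Matrix.nonsing_inv_mul _ hu, Matrix.one_mul]

theorem SpinLifting.hol_sym2Mat_lift {W : SOBundle X 3} (S : SpinLifting W) (i j : S.ι) :
    HolMat (fun x => sym2Mat (S.lift i j x)) (S.U i ∩ S.U j) := by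
  have hi : HolMat (S.h i) (S.U i ∩ S.U j) := (S.h_hol i).mono Set.inter_subset_left
  have hj : HolMat (S.h j) (S.U i ∩ S.U j) := (S.h_hol j).mono Set.inter_subset_right
  have hq : HolMat (W.q (S.r i)) (S.U i ∩ S.U j) :=
    (W.q_hol _).mono fun x hx => S.subset i hx.1
  have hg : HolMat (W.g (S.r i) (S.r j)) (S.U i ∩ S.U j) :=
    (W.hol _ _).mono fun x hx => ⟨S.subset i hx.1, S.subset j hx.2⟩
  exact ((holMat_const _ _).mul ((hi.transpose.mul hq).mul (hg.mul hj))).congr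
    fun x hx => S.sym2Mat_lift hx.1 hx.2

/-- The vector bundle `V` of a spin structure: the lifts, corrected by signs `(-1) ^ η` on a
refinement `D` of the cover on which the obstruction cocycle is the coboundary of `η`. -/
def SpinLifting.spinBundle {W : SOBundle X 3} (S : SpinLifting W) {c : Cech2Cocycle S.toCover}
    (hS : S.IsObstruction c) (D : Cover X) (r : D.ι → S.ι) (η : D.ι → D.ι → X → ZMod 2)
    (hr : ∀ i, D.U i ⊆ S.U (r i)) (hη : ∀ i j, ContinuousOn (η i j) (D.U i ∩ D.U j))
    (hc : ∀ i j k x, x ∈ D.U i → x ∈ D.U j → x ∈ D.U k →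
      c.c (r i) (r j) (r k) x = η j k x - η i k x + η i j x) : SL2Bundle X :=
  have hdet : ∀ i j x, x ∈ D.U i → x ∈ D.U j →
      ((-1 : ℂ) ^ (η i j x).val • S.lift (r i) (r j) x).det = 1 := fun i j x hi hj => by
    rw [det_neg_one_pow_smul, S.det_lift _ _ x (hr i hi) (hr j hj)]
  have hcomp : ∀ i j k x, x ∈ D.U i → x ∈ D.U j → x ∈ D.U k →
      ((-1 : ℂ) ^ (η i j x).val • S.lift (r i) (r j) x) *
        ((-1 : ℂ) ^ (η j k x).val • S.lift (r j) (r k) x) =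
      (-1 : ℂ) ^ (η i k x).val • S.lift (r i) (r k) x := fun i j k x hi hj hk => by
    rw [smul_mul_smul_comm, hS _ _ _ x (hr i hi) (hr j hj) (hr k hk), smul_smul,
      ← neg_one_pow_val_add, ← neg_one_pow_val_add, hc i j k x hi hj hk]
    congr 3
    generalize η i j x = a
    generalize η j k x = b
    generalize η i k x = d
    revert a b d
    decide
  { toCover := D
    g := fun i j x => (-1 : ℂ) ^ (η i j x).val • S.lift (r i) (r j) x
    hol := fun i j => by
      have hsub : D.U i ∩ D.U j ⊆ S.U (r i) ∩ S.U (r j) := fun x hx => ⟨hr i hx.1, hr j hx.2⟩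
      refine holMat_of_sym2Mat ((D.isOpen i).inter (D.isOpen j)) ?_
        (fun x hx => hdet i j x hx.1 hx.2) ?_
      · refine ContinuousOn.smul (f := fun x => (-1 : ℂ) ^ (η i j x).val) ?_
          ((S.lift_continuousOn _ _).mono hsub)
        have hsign : Continuous fun a : ZMod 2 => (-1 : ℂ) ^ a.val :=
          continuous_of_discreteTopology
        exact hsign.comp_continuousOn (hη i j)
      · simp only [sym2Mat_neg_one_pow_smul]
        exact (S.hol_sym2Mat_lift (r i) (r j)).mono hsub
    g_self := fun i x hi => by
      have hu : IsUnit ((-1 : ℂ) ^ (η i i x).val • S.lift (r i) (r i) x) := by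
        rw [Matrix.isUnit_iff_isUnit_det, hdet i i x hi hi]
        exact isUnit_one
      exact hu.mul_left_cancel (by rw [hcomp i i i x hi hi hi, mul_one])
    g_comp := hcomp
    det_g := hdet }

variable [IsManifold 𝓘(ℂ) ω X]

/-- Trace-free local Higgs fields `M i c` whose rows `β` transform as a twisted form on `Sym² V`
glue to a Higgs field, since `β` determines `φ`. -/
def SL2Bundle.higgsOfLocal (V : SL2Bundle X)
    (M : V.ι → (canonical X).ι → X → Matrix (Fin 2) (Fin 2) ℂ)
    (hol : ∀ i c, HolMat (M i c) (V.U i ∩ (canonical X).U c))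
    (trace : ∀ i c x, (M i c x).trace = 0)
    (compat : ∀ i j c d x, x ∈ V.U i → x ∈ V.U j → x ∈ (canonical X).U c →
      x ∈ (canonical X).U d → betaMat (M j d x) =
        (canonical X).g d c x 0 0 • (betaMat (M i c x) * sym2Mat (V.g i j x))) :
    SL2Higgs X :=
  have hM : ∀ i j c d x, x ∈ V.U i → x ∈ V.U j → x ∈ (canonical X).U c →
      x ∈ (canonical X).U d →
      M j d x = (canonical X).g d c x 0 0 • (V.g j i x * M i c x * V.g i j x) := by
    intro i j c d x hi hj hc hd
    have htr : (V.g j i x * M i c x * V.g i j x).trace = 0 := by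
      rw [Matrix.trace_mul_comm, ← mul_assoc, V.g_mul_g_symm hi hj, one_mul, trace]
    rw [← phiMat_betaMat (trace j d x), compat i j c d x hi hj hc hd,
      ← betaMat_conj (V.det_g i j x hi hj) (V.g_mul_g_symm hj hi) (trace i c x), ← betaMat_smul,
      phiMat_betaMat]
    rw [Matrix.trace_smul, htr, smul_zero]
  { toSL2Bundle := V
    φ :=
      { f := fun a i c x => V.g a i x * M i c x
        hol := fun a i c =>
          ((V.hol a i).mono fun x hx => hx.1).mul
            ((hol i c).mono fun x hx => ⟨hx.1.2, hx.2⟩)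
        compat := fun a b i j c d x ha hb hi hj hc hd => by
          rw [hM i j c d x hi hj hc hd, Matrix.mul_smul, ← mul_assoc, ← mul_assoc, ← mul_assoc,
            V.g_comp b j i x hb hj hi, V.g_comp b a i x hb ha hi] }
    trace_φ := fun i c x hi _ => by
      change (V.g i i x * M i c x).trace = 0
      rw [V.g_self i x hi, one_mul, trace] }

/-- An `SO₀(1, 3)`-Higgs bundle with `w₂ = 0` comes from an `SL(2, ℂ)`-Higgs bundle. -/
theorem SO13Higgs.exists_sym2_iso (H : SO13Higgs X) (hw : H.W2EqZero) :
    ∃ G : SL2Higgs X, Nonempty (SO13Higgs.Iso G.sym2 H) := by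
  obtain ⟨S, c, hS, D, r, η, hr, hη, hc⟩ := hw
  let V : SL2Bundle X := S.spinBundle hS D r η hr hη hc
  have hsym : ∀ i j x, sym2Mat (V.g i j x) = sym2Mat (S.lift (r i) (r j) x) := fun i j x =>
    sym2Mat_neg_one_pow_smul _ _
  let M : V.ι → (canonical X).ι → X → Matrix (Fin 2) (Fin 2) ℂ := fun i c x =>
    phiMat (H.β.f PUnit.unit (S.r (r i)) c x * S.h (r i) x)
  have hsub : ∀ i, V.U i ⊆ H.U (S.r (r i)) := fun i x hx => S.subset _ (hr i hx)
  have hhol : ∀ i : D.ι, HolMat (S.h (r i)) (V.U i) := fun i => (S.h_hol (r i)).mono (hr i)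
  have hMhol : ∀ i c, HolMat (M i c) (V.U i ∩ (canonical X).U c) := by
    intro i c
    have hB : HolMat (fun x => H.β.f PUnit.unit (S.r (r i)) c x * S.h (r i) x)
        (V.U i ∩ (canonical X).U c) :=
      ((H.β.hol PUnit.unit _ c).mono fun x hx => ⟨⟨trivial, hsub i hx.1⟩, hx.2⟩).mul
        ((hhol i).mono fun x hx => hx.1)
    have hhalf : HolOn (fun x => (H.β.f PUnit.unit (S.r (r i)) c x * S.h (r i) x) 0 1 / 2)
        (V.U i ∩ (canonical X).U c) :=
      ((hB 0 1).mul (holOn_const (2⁻¹) _)).congr fun x _ => div_eq_mul_inv _ _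
    intro a b
    fin_cases a <;> fin_cases b
    · exact hhalf
    · exact hB 0 2
    · exact (hB 0 0).neg
    · exact hhalf.neg
  have hMcompat : ∀ i j c d x, x ∈ V.U i → x ∈ V.U j → x ∈ (canonical X).U c →
      x ∈ (canonical X).U d → betaMat (M j d x) =
        (canonical X).g d c x 0 0 • (betaMat (M i c x) * sym2Mat (V.g i j x)) := by
    intro i j c d x hi hj hc hd
    simp only [M, betaMat_phiMat]
    rw [hsym, Matrix.mul_assoc, S.lift_eq _ _ x (hr i hi) (hr j hj),
      H.beta_compat (hsub i hi) (hsub j hj) hc hd, Matrix.smul_mul, Matrix.mul_assoc]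
  have hfcompat : ∀ (a b : H.ι) (i j : V.ι) x, x ∈ H.U a → x ∈ H.U b → x ∈ V.U i → x ∈ V.U j →
      H.g b (S.r (r j)) x * S.h (r j) x =
        H.g b a x * (H.g a (S.r (r i)) x * S.h (r i) x) * sym2Mat (V.g i j x) := by
    intro a b i j x ha hb hi hj
    rw [hsym, Matrix.mul_assoc, Matrix.mul_assoc, S.lift_eq _ _ x (hr i hi) (hr j hj),
      ← Matrix.mul_assoc (H.g a _ x), H.g_comp _ _ _ x ha (hsub i hi) (hsub j hj),
      ← Matrix.mul_assoc, H.g_comp _ _ _ x hb ha (hsub j hj)]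
  have hfcomm : ∀ (a : H.ι) (i : V.ι) (c : (canonical X).ι) x, x ∈ H.U a → x ∈ V.U i →
      x ∈ (canonical X).U c →
      H.β.f PUnit.unit a c x * (H.g a (S.r (r i)) x * S.h (r i) x) =
        betaMat (V.g i i x * M i c x) := by
    intro a i c x ha hi hc
    rw [V.g_self i x hi, one_mul, betaMat_phiMat, ← Matrix.mul_assoc,
      H.beta_mul_g ha (hsub i hi) hc]
  refine ⟨V.higgsOfLocal M hMhol (fun i c x => trace_phiMat _) hMcompat, ⟨?_⟩⟩
  exact
    { f := fun a i x => H.g a (S.r (r i)) x * S.h (r i) x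
      hol := fun a i =>
        ((H.hol a _).mono fun x hx => ⟨hx.1, hsub i hx.2⟩).mul
          ((hhol i).mono fun x hx => hx.2)
      compat := hfcompat
      isometry := fun a i x ha hi => by
        change _ = q₃
        rw [← S.isometry _ x (hr i hi), H.q_compat a _ x ha (hsub i hi), Matrix.transpose_mul]
        simp only [Matrix.mul_assoc]
      orient := fun a i x ha hi => by
        change _ = -(Real.sqrt 2 : ℂ)
        rw [← S.orient _ x (hr i hi), H.δ_compat a _ x ha (hsub i hi), Matrix.det_mul]
        ring
      comm := hfcomm }

/-- The bundle `Sym² V` has the spin structure `V`. -/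
theorem SL2Higgs.sym2_w2EqZero (H : SL2Higgs X) : H.sym2.W2EqZero := by
  let S : SpinLifting H.sym2.toSOBundle :=
    { toCover := H.toCover
      r := id
      subset := fun i => subset_rfl
      h := fun _ _ => 1
      h_hol := fun i => holMat_const 1 _
      isometry := fun i x hi => by
        change 1ᵀ * q₃ * 1 = q₃
        simp
      orient := fun i x hi => by
        change Matrix.det 1 * -(Real.sqrt 2 : ℂ) = _
        simp
      lift := H.g
      lift_continuousOn := fun i j => (H.hol i j).continuousOn
      det_lift := H.det_g
      lift_eq := fun i j x hi hj => (one_mul _).trans (mul_one _).symm }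
  let c : Cech2Cocycle S.toCover :=
    { c := fun _ _ _ _ => 0
      continuousOn := fun _ _ _ => continuousOn_const
      cocycle := fun _ _ _ _ _ _ _ _ _ => by simp }
  refine ⟨S, c, fun i j k x hi hj hk => ?_, H.toCover, id, fun _ _ _ => 0, fun i => subset_rfl,
    fun _ _ => continuousOn_const, fun _ _ _ _ _ _ _ => by simp [c]⟩
  simp only [c, ZMod.val_zero, pow_zero, one_smul]
  exact H.g_comp i j k x hi hj hk

end Spin

/-! ### Isotropic lines in `Sym² V` are squares of lines in `V` -/

section IsotropicLines

/-- A vector of `ℂ²` whose square is proportional to a given isotropic vector of `Sym² ℂ²`: the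
vector `(S₀, S₁)` for `k = 0` and `(S₁, S₂)` for `k = 1`. -/
def rootVec (k : Fin 2) (S : Matrix (Fin 3) (Fin 1) ℂ) : Matrix (Fin 2) (Fin 1) ℂ :=
  Matrix.of fun r _ => S ⟨k + r, by omega⟩ 0

theorem mul_eq_sq_of_isotropic {S : Matrix (Fin 3) (Fin 1) ℂ} (h : Sᵀ * q₃ * S = 0) :
    S 0 0 * S 2 0 = S 1 0 ^ 2 := by
  have := congrFun (congrFun h 0) 0
  simp [q₃, Matrix.mul_apply, Fin.sum_univ_succ] at this
  linear_combination (1 / 2) * this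

theorem sqVec_rootVec (k : Fin 2) {S : Matrix (Fin 3) (Fin 1) ℂ} (h : Sᵀ * q₃ * S = 0) :
    sqVec (rootVec k S) = rootVec k S k 0 • S := by
  have h := mul_eq_sq_of_isotropic h
  ext r t
  fin_cases k <;> fin_cases r <;> fin_cases t <;> simp [sqVec, rootVec, pow_two] <;>
    first
      | linear_combination -h
      | ring

theorem exists_rootVec_ne_zero {S : Matrix (Fin 3) (Fin 1) ℂ} (h : Sᵀ * q₃ * S = 0)
    (hS : S ≠ 0) : ∃ k, rootVec k S k 0 ≠ 0 := by
  by_contra! h0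
  have a : S 0 0 = 0 := h0 0
  have c : S 2 0 = 0 := h0 1
  have b : S 1 0 = 0 := by
    have := mul_eq_sq_of_isotropic h
    rw [a, zero_mul] at this
    exact pow_eq_zero_iff two_ne_zero |>.1 this.symm
  refine hS ?_
  ext r t
  fin_cases r <;> fin_cases t <;> simp [a, b, c]

theorem mul_matrix_one {n : ℕ} (A : Matrix (Fin n) (Fin 1) ℂ) (B : Matrix (Fin 1) (Fin 1) ℂ) :
    A * B = B 0 0 • A := by
  ext r t
  rw [Subsingleton.elim t 0]
  simp [Matrix.mul_apply, mul_comm]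

end IsotropicLines

section LineBundles

variable {X : Type u} [TopologicalSpace X] [ChartedSpace ℂ X]

theorem HolVB.line_g_ne_zero (L : HolVB X 1) {i j : L.ι} {x : X} (hi : x ∈ L.U i)
    (hj : x ∈ L.U j) : L.g i j x 0 0 ≠ 0 := by
  intro h
  have := congrFun (congrFun (L.g_mul_g_symm hi hj) 0) 0
  simp [Matrix.mul_apply, h] at this

/-- Local generators of a line subbundle of `E`: sections `ℓ` over a cover finer than that of `E`,
with a coordinate `k` which is nowhere zero, and which are proportional on overlaps. -/
structure LineFrames {n : ℕ} (E : HolVB X n) extends Cover X where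
  r : ι → E.ι
  subset : ∀ i, U i ⊆ E.U (r i)
  ℓ : ι → X → Matrix (Fin n) (Fin 1) ℂ
  hol : ∀ i, HolMat (ℓ i) (U i)
  k : ι → Fin n
  ne_zero : ∀ i, ∀ x ∈ U i, ℓ i x (k i) 0 ≠ 0
  proportional : ∀ i j x, x ∈ U i → x ∈ U j →
    ∃ t : ℂ, E.g (r i) (r j) x * ℓ j x = t • ℓ i x

/-- The ratio of two generators, read off from the nonzero coordinate. -/
def LineFrames.ratio {n : ℕ} {E : HolVB X n} (F : LineFrames E) (i j : F.ι) (x : X) : ℂ :=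
  (E.g (F.r i) (F.r j) x * F.ℓ j x) (F.k i) 0 * (F.ℓ i x (F.k i) 0)⁻¹

theorem LineFrames.ℓ_ne_zero {n : ℕ} {E : HolVB X n} (F : LineFrames E) {i : F.ι} {x : X}
    (hi : x ∈ F.U i) : F.ℓ i x ≠ 0 := fun h => F.ne_zero i x hi (by rw [h]; rfl)

theorem LineFrames.g_mul_ℓ {n : ℕ} {E : HolVB X n} (F : LineFrames E) {i j : F.ι} {x : X}
    (hi : x ∈ F.U i) (hj : x ∈ F.U j) :
    E.g (F.r i) (F.r j) x * F.ℓ j x = F.ratio i j x • F.ℓ i x := by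
  obtain ⟨t, ht⟩ := F.proportional i j x hi hj
  rw [LineFrames.ratio, ht, Matrix.smul_apply, smul_eq_mul, mul_assoc,
    mul_inv_cancel₀ (F.ne_zero i x hi), mul_one]

/-- The line bundle with the given generators. -/
def LineFrames.bundle {n : ℕ} {E : HolVB X n} (F : LineFrames E) : HolVB X 1 where
  toCover := F.toCover
  g i j x := !![F.ratio i j x]
  hol i j r t := by
    rw [Subsingleton.elim r 0, Subsingleton.elim t 0]
    have h1 : HolMat (fun x => E.g (F.r i) (F.r j) x * F.ℓ j x) (F.U i ∩ F.U j) :=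
      ((E.hol _ _).mono fun x hx => ⟨F.subset i hx.1, F.subset j hx.2⟩).mul
        ((F.hol j).mono Set.inter_subset_right)
    exact (h1 _ _).mul (((F.hol i _ _).mono Set.inter_subset_left).inv
      fun x hx => F.ne_zero i x hx.1)
  g_self i x hi := by
    ext r t
    rw [Subsingleton.elim r 0, Subsingleton.elim t 0]
    simp [LineFrames.ratio, E.g_self _ x (F.subset i hi), F.ne_zero i x hi]
  g_comp i j k x hi hj hk := by
    have h : (F.ratio i j x * F.ratio j k x) • F.ℓ i x = F.ratio i k x • F.ℓ i x := by
      rw [mul_comm, mul_smul, ← F.g_mul_ℓ hi hj, ← Matrix.mul_smul, ← F.g_mul_ℓ hj hk,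
        ← Matrix.mul_assoc, E.g_comp _ _ _ x (F.subset i hi) (F.subset j hj) (F.subset k hk),
        F.g_mul_ℓ hi hk]
    ext r t
    rw [Subsingleton.elim r 0, Subsingleton.elim t 0]
    simpa using smul_left_injective ℂ (F.ℓ_ne_zero hi) h

/-- The inclusion into `E` of the line bundle with the given generators. -/
def LineFrames.inclusion {n : ℕ} {E : HolVB X n} (F : LineFrames E) : VBHom F.bundle E where
  f a i x := E.g a (F.r i) x * F.ℓ i x
  hol a i := ((E.hol a _).mono fun x hx => ⟨hx.1, F.subset i hx.2⟩).mul
    ((F.hol i).mono fun x hx => hx.2)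
  compat := by
    have h : ∀ (a b : E.ι) (i j : F.ι) x, x ∈ E.U a → x ∈ E.U b → x ∈ F.U i → x ∈ F.U j →
        E.g b (F.r j) x * F.ℓ j x =
          E.g b a x * (E.g a (F.r i) x * F.ℓ i x) * !![F.ratio i j x] := by
      intro a b i j x ha hb hi hj
      have hi' := F.subset i hi
      have hj' := F.subset j hj
      have hg : !![F.ratio i j x] 0 0 = F.ratio i j x := rfl
      rw [mul_matrix_one, hg, ← Matrix.mul_smul, ← Matrix.mul_smul, ← F.g_mul_ℓ hi hj,
        ← Matrix.mul_assoc, ← Matrix.mul_assoc, E.g_comp b a _ x hb ha hi',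
        E.g_comp b _ _ x hb hi' hj']
    exact h

theorem LineFrames.inclusion_ne_zero {n : ℕ} {E : HolVB X n} (F : LineFrames E) {a : E.ι}
    {i : F.ι} {x : X} (ha : x ∈ E.U a) (hi : x ∈ F.U i) : F.inclusion.f a i x ≠ 0 := by
  intro h
  refine F.ℓ_ne_zero hi ?_
  have := congrArg (E.g (F.r i) a x * ·) h
  simpa only [LineFrames.inclusion, ← Matrix.mul_assoc, E.g_mul_g_symm (F.subset i hi) ha,
    Matrix.one_mul, Matrix.mul_zero] using this

theorem VBHom.g_mul_line {n : ℕ} {N : HolVB X 1} {E : HolVB X n} (s : VBHom N E) {a b : E.ι}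
    {i j : N.ι} {x : X} (ha : x ∈ E.U a) (hb : x ∈ E.U b) (hi : x ∈ N.U i) (hj : x ∈ N.U j) :
    E.g a b x * s.f b j x = N.g i j x 0 0 • s.f a i x := by
  rw [← s.eq_mul hb ha hj, s.mul_eq ha hi hj, mul_matrix_one]

/-- The square root `L ⊆ V` of an isotropic line subbundle `N ⊆ Sym² V`, generated by the vectors
`rootVec k s` on the open sets where they have a nonzero `k`-th coordinate. -/
def rootFrames (V : SL2Bundle X) {N : HolVB X 1} (s : VBHom N V.sym2.toHolVB)
    (hs : ∀ i n x, x ∈ V.U i → x ∈ N.U n → s.f i n x ≠ 0)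
    (hiso : ∀ i n x, x ∈ V.U i → x ∈ N.U n → (s.f i n x)ᵀ * q₃ * s.f i n x = 0) :
    LineFrames V.toHolVB where
  ι := N.ι × V.ι × ULift.{u} (Fin 2)
  U p := (V.U p.2.1 ∩ N.U p.1) ∩
    {x | rootVec p.2.2.down (s.f p.2.1 p.1 x) p.2.2.down 0 ≠ 0}
  isOpen p := by
    have h : HolOn (fun x => rootVec p.2.2.down (s.f p.2.1 p.1 x) p.2.2.down 0)
        (V.U p.2.1 ∩ N.U p.1) := s.hol p.2.1 p.1 _ _
    exact h.continuousOn.isOpen_inter_preimage ((V.isOpen _).inter (N.isOpen _)) isOpen_ne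
  exists_mem x := by
    obtain ⟨i, hi⟩ := V.exists_mem x
    obtain ⟨n, hn⟩ := N.exists_mem x
    obtain ⟨k, hk⟩ := exists_rootVec_ne_zero (hiso i n x hi hn) (hs i n x hi hn)
    exact ⟨(n, i, ⟨k⟩), ⟨hi, hn⟩, hk⟩
  r p := p.2.1
  subset p x hx := hx.1.1
  ℓ p x := rootVec p.2.2.down (s.f p.2.1 p.1 x)
  hol p _ _ := (s.hol p.2.1 p.1 _ _).mono fun x hx => hx.1
  k p := p.2.2.down
  ne_zero p x hx := hx.2
  proportional := by
    rintro ⟨n, i, ⟨k⟩⟩ ⟨m, j, ⟨l⟩⟩ x ⟨⟨hi, hn⟩, hk⟩ ⟨⟨hj, hm⟩, hl⟩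
    have hv : rootVec k (s.f i n x) ≠ 0 := fun h => hk (by simp [h])
    refine exists_eq_smul_of_sqVec hv
      (k := rootVec l (s.f j m x) l 0 * N.g n m x 0 0 * (rootVec k (s.f i n x) k 0)⁻¹) ?_
    have hg : sym2Mat (V.g i j x) * s.f j m x = N.g n m x 0 0 • s.f i n x :=
      s.g_mul_line hi hj hn hm
    rw [sqVec_mul, sqVec_rootVec l (hiso j m x hj hm), sqVec_rootVec k (hiso i n x hi hn),
      Matrix.mul_smul, hg, smul_smul, smul_smul, mul_assoc _ (_)⁻¹, inv_mul_cancel₀ hk, mul_one]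

/-- The transition functions of the square root `L` of `N`: squared, they are those of `N` up to
the factors comparing the squares of the generators of `L` with the generators of `N`. -/
theorem rootFrames_ratio_sq (V : SL2Bundle X) {N : HolVB X 1} (s : VBHom N V.sym2.toHolVB)
    (hs : ∀ i n x, x ∈ V.U i → x ∈ N.U n → s.f i n x ≠ 0)
    (hiso : ∀ i n x, x ∈ V.U i → x ∈ N.U n → (s.f i n x)ᵀ * q₃ * s.f i n x = 0)
    {p q : (rootFrames V s hs hiso).ι} {x : X} (hp : x ∈ (rootFrames V s hs hiso).U p)
    (hq : x ∈ (rootFrames V s hs hiso).U q) :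
    (rootFrames V s hs hiso).ratio p q x ^ 2 *
        rootVec p.2.2.down (s.f p.2.1 p.1 x) p.2.2.down 0 =
      rootVec q.2.2.down (s.f q.2.1 q.1 x) q.2.2.down 0 * N.g p.1 q.1 x 0 0 := by
  have h := (rootFrames V s hs hiso).g_mul_ℓ hp hq
  have h2 := congrArg sqVec h
  change sqVec (V.g p.2.1 q.2.1 x * rootVec q.2.2.down (s.f q.2.1 q.1 x)) =
    sqVec (_ • rootVec p.2.2.down (s.f p.2.1 p.1 x)) at h2
  have hg : sym2Mat (V.g p.2.1 q.2.1 x) * s.f q.2.1 q.1 x =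
      N.g p.1 q.1 x 0 0 • s.f p.2.1 p.1 x :=
    s.g_mul_line hp.1.1 hq.1.1 hp.1.2 hq.1.2
  rw [sqVec_mul, sqVec_smul, sqVec_rootVec _ (hiso _ _ x hp.1.1 hp.1.2),
    sqVec_rootVec _ (hiso _ _ x hq.1.1 hq.1.2), Matrix.mul_smul, hg, smul_smul, smul_smul] at h2
  exact (smul_left_injective ℂ (hs _ _ x hp.1.1 hp.1.2) h2).symm

variable [IsManifold 𝓘(ℂ) ω X]

/-- `deg L = deg N / 2` for the square root `L` of `N`: a metric `h` on `N` gives the metric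
`|λ| √h` on `L`, where the square of a generator of `L` is `λ` times a generator of `N`. -/
theorem hasDegree_rootFrames (V : SL2Bundle X) {N : HolVB X 1} (s : VBHom N V.sym2.toHolVB)
    (hs : ∀ i n x, x ∈ V.U i → x ∈ N.U n → s.f i n x ≠ 0)
    (hiso : ∀ i n x, x ∈ V.U i → x ∈ N.U n → (s.f i n x)ᵀ * q₃ * s.f i n x = 0)
    {d : ℝ} (hd : HasDegree N d) :
    HasDegree (rootFrames V s hs hiso).bundle ((1 / 2) * d) := by
  let F := rootFrames V s hs hiso
  let lam : F.ι → X → ℂ := fun p x => rootVec p.2.2.down (s.f p.2.1 p.1 x) p.2.2.down 0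
  have hlam : ∀ p, HolOn (lam p) (F.U p) := fun p => (F.hol p _ _)
  have hlam0 : ∀ p x, x ∈ F.U p → lam p x ≠ 0 := fun p x hx => hx.2
  refine hd.of_metric fun m => ⟨
    { h := fun p x => ‖lam p x‖ * √(m.h p.1 x)
      pos := fun p x hx =>
        mul_pos (norm_pos_iff.2 (hlam0 p x hx)) (Real.sqrt_pos.2 (m.pos _ x hx.1.2))
      smooth := fun p x hx => ?_
      compat := fun p q x hp hq => ?_ }, fun p n x => lam p x * N.g n p.1 x 0 0, ?_, ?_, ?_⟩
  · have h1 : ContMDiffWithinAt 𝓘(ℝ, ℂ) 𝓘(ℝ, ℝ) ∞ (fun y => ‖lam p y‖) (F.U p) x :=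
      (contDiffAt_norm ℝ (hlam0 p x hx)).comp_contMDiffWithinAt
        ((hlam p).contMDiffOn (F.isOpen p) x hx)
    have h2 : ContMDiffWithinAt 𝓘(ℝ, ℂ) 𝓘(ℝ, ℝ) ∞ (fun y => √(m.h p.1 y)) (F.U p) x :=
      (Real.contDiffAt_sqrt (m.pos _ x hx.1.2).ne').comp_contMDiffWithinAt
        ((m.smooth p.1 x hx.1.2).mono fun y hy => hy.1.2)
    exact h1.smul h2
  · have h := congrArg norm (rootFrames_ratio_sq V s hs hiso hp hq)
    rw [norm_mul, norm_pow, norm_mul] at h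
    change ‖lam q x‖ * √(m.h q.1 x) = ‖F.ratio p q x‖ ^ 2 * (‖lam p x‖ * √(m.h p.1 x))
    rw [m.compat p.1 q.1 x hp.1.2 hq.1.2, Real.sqrt_mul (by positivity),
      Real.sqrt_sq (norm_nonneg _), ← mul_assoc, ← mul_assoc, h]
  · intro p n
    exact ((hlam p).mono Set.inter_subset_left).mul
      ((N.hol n p.1 0 0).mono fun x hx => ⟨hx.2, hx.1.1.2⟩)
  · intro p n x hp hn
    exact mul_ne_zero (hlam0 p x hp) (N.line_g_ne_zero hn hp.1.2)
  · intro p n x hp hn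
    have h1 : ‖lam p x‖ ≠ 0 := norm_ne_zero_iff.2 (hlam0 p x hp)
    have h2 : ‖N.g n p.1 x 0 0‖ ≠ 0 := norm_ne_zero_iff.2 (N.line_g_ne_zero hn hp.1.2)
    have h3 := m.pos n x hn
    change Real.log (‖lam p x‖ * √(m.h p.1 x)) = _
    rw [m.compat n p.1 x hn hp.1.2, Real.sqrt_mul (by positivity), Real.sqrt_sq (norm_nonneg _),
      norm_mul, Real.log_mul h1 (mul_ne_zero h2 (Real.sqrt_ne_zero'.2 h3)),
      Real.log_mul h2 (Real.sqrt_ne_zero'.2 h3), Real.log_mul h1 h2, Real.log_sqrt h3.le]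
    ring

/-- The line bundle `L²`, on a common refinement of the cover of `L` and another cover. -/
def squareLine (L : HolVB X 1) (C : Cover X) : HolVB X 1 where
  ι := L.ι × C.ι
  U p := L.U p.1 ∩ C.U p.2
  isOpen p := (L.isOpen _).inter (C.isOpen _)
  exists_mem x := by
    obtain ⟨l, hl⟩ := L.exists_mem x
    obtain ⟨i, hi⟩ := C.exists_mem x
    exact ⟨(l, i), hl, hi⟩
  g p q x := L.g p.1 q.1 x * L.g p.1 q.1 x
  hol p q := by
    have h : HolMat (L.g p.1 q.1) ((L.U p.1 ∩ C.U p.2) ∩ (L.U q.1 ∩ C.U q.2)) :=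
      (L.hol _ _).mono fun x hx => ⟨hx.1.1, hx.2.1⟩
    exact h.mul h
  g_self p x hp := by rw [L.g_self _ x hp.1, one_mul]
  g_comp p q r x hp hq hr := by
    rw [← L.g_comp p.1 q.1 r.1 x hp.1 hq.1 hr.1]
    ext a b
    rw [Subsingleton.elim a 0, Subsingleton.elim b 0]
    simp [Matrix.mul_apply]
    ring

theorem hasDegree_squareLine {L : HolVB X 1} (C : Cover X) {d : ℝ} (hd : HasDegree L d) :
    HasDegree (squareLine L C) (2 * d) := by
  refine hd.of_metric fun m => ⟨
    { h := fun p x => m.h p.1 x * m.h p.1 x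
      pos := fun p x hx => mul_pos (m.pos _ x hx.1) (m.pos _ x hx.1)
      smooth := fun p => ?_
      compat := fun p q x hp hq => ?_ },
    fun p l x => (L.g l p.1 x 0 0 * L.g l p.1 x 0 0) * (L.g l p.1 x 0 0 * L.g l p.1 x 0 0),
    ?_, ?_, ?_⟩
  · have h := (m.smooth p.1).mono (Set.inter_subset_left (t := C.U p.2))
    exact ContMDiffOn.smul h h
  · rw [m.compat p.1 q.1 x hp.1 hq.1]
    simp [squareLine, Matrix.mul_apply]
    ring
  · intro p l
    have h : HolOn (fun x => L.g l p.1 x 0 0) ((squareLine L C).U p ∩ L.U l) :=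
      (L.hol l p.1 0 0).mono fun x hx => ⟨hx.2, hx.1.1⟩
    exact (h.mul h).mul (h.mul h)
  · intro p l x hp hl
    have := L.line_g_ne_zero hl hp.1
    positivity
  · intro p l x hp hl
    have h2 : ‖L.g l p.1 x 0 0‖ ≠ 0 := norm_ne_zero_iff.2 (L.line_g_ne_zero hl hp.1)
    have h3 := (m.pos l x hl).ne'
    have h4 := mul_ne_zero h2 h2
    change Real.log (m.h p.1 x * m.h p.1 x) =
      Real.log ‖(L.g l p.1 x 0 0 * L.g l p.1 x 0 0) * (L.g l p.1 x 0 0 * L.g l p.1 x 0 0)‖ +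
        2 * Real.log (m.h l x)
    rw [m.compat l p.1 x hl hp.1, norm_mul, norm_mul, pow_two,
      Real.log_mul (mul_ne_zero h4 h3) (mul_ne_zero h4 h3), Real.log_mul h4 h3,
      Real.log_mul h4 h4]
    ring

end LineBundles

/-! ### Semistability -/

section Semistability

variable {X : Type u} [TopologicalSpace X] [ChartedSpace ℂ X] [IsManifold 𝓘(ℂ) ω X]

/-- A destabilizing isotropic line `N ⊆ Sym² V` is the square of a destabilizing line `L ⊆ V`. -/
theorem SL2Higgs.IsSemistable.sym2 {H : SL2Higgs X} (h : H.IsSemistable) :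
    H.sym2.IsSemistable := by
  intro N s hs hiso hβ d hd
  let F := rootFrames H.toSL2Bundle s hs hiso
  have key := h F.bundle F.inclusion (fun i p x hi hp => F.inclusion_ne_zero hi hp)
    (fun i p c x hi hp hc => ?_) _ (hasDegree_rootFrames H.toSL2Bundle s hs hiso hd)
  · linarith
  · have hp' : x ∈ H.U p.2.1 := hp.1.1
    have hv : F.ℓ p x ≠ 0 := F.ℓ_ne_zero hp
    have hb : betaMat (H.φ.f p.2.1 p.2.1 c x) * s.f p.2.1 p.1 x = 0 :=
      hβ p.2.1 p.1 c x hp' hp.1.2 hc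
    have h0 : betaMat (H.φ.f p.2.1 p.2.1 c x) * sqVec (F.ℓ p x) = 0 := by
      have hℓ : F.ℓ p x = rootVec p.2.2.down (s.f p.2.1 p.1 x) := rfl
      rw [hℓ, sqVec_rootVec _ (hiso _ _ x hp' hp.1.2), Matrix.mul_smul, hb, smul_zero]
    obtain ⟨k, hk⟩ := exists_eigenvalue_of_betaMat_mul_sqVec (H.trace_φ _ c x hp' hc) hv h0
    refine ⟨k, ?_⟩
    change H.φ.f i i c x * (H.g i p.2.1 x * F.ℓ p x) = k • (H.g i p.2.1 x * F.ℓ p x)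
    rw [← Matrix.mul_assoc, H.φ.mul_g hi hp' hc, Matrix.mul_assoc, hk, Matrix.mul_smul]

/-- The square of a destabilizing line `L ⊆ V` is a destabilizing isotropic line in `Sym² V`. -/
theorem SL2Higgs.isSemistable_of_sym2_iso {G : SL2Higgs X} {H : SO13Higgs X}
    (T : SO13Higgs.Iso G.sym2 H) (h : H.IsSemistable) : G.IsSemistable := by
  intro L s hs hinv d hd
  let N := squareLine L G.toCover
  have hq₃ : IsUnit q₃.det := by rw [det_q₃]; exact isUnit_iff_ne_zero.2 two_ne_zero
  have hT : ∀ a (i : G.ι) x, x ∈ H.U a → x ∈ G.U i →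
      (T.f a i x)ᵀ * H.q a x * T.f a i x = q₃ := T.isometry
  let sq : VBHom N H.toHolVB :=
    { f := fun a p x => T.f a p.2 x * sqVec (s.f p.2 p.1 x)
      hol := fun a p => by
        have hsp : HolMat (s.f p.2 p.1) (H.U a ∩ N.U p) :=
          (s.hol p.2 p.1).mono fun x hx => ⟨hx.2.2, hx.2.1⟩
        refine ((T.hol a p.2).mono fun x hx => ⟨hx.1, hx.2.2⟩).mul fun r t => ?_
        rw [Subsingleton.elim t 0]
        fin_cases r <;> simp only [sqVec, pow_two]
        · exact (hsp _ _).mul (hsp _ _)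
        · exact (hsp _ _).mul (hsp _ _)
        · exact (hsp _ _).mul (hsp _ _)
      compat := fun a b p q x ha hb hp hq => by
        have hg : N.g p q x 0 0 = L.g p.1 q.1 x 0 0 ^ 2 := by
          simp [N, squareLine, Matrix.mul_apply, pow_two]
        have hTq : T.f b q.2 x = H.g b a x * T.f a p.2 x * sym2Mat (G.g p.2 q.2 x) :=
          T.compat a b p.2 q.2 x ha hb hp.2 hq.2
        rw [mul_matrix_one, hg, hTq, Matrix.mul_assoc _ (sym2Mat _), ← sqVec_mul,
          s.g_mul_line hp.2 hq.2 hp.1 hq.1, sqVec_smul, Matrix.mul_smul, Matrix.mul_assoc] }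
  have key := h N sq ?_ ?_ ?_ _ (hasDegree_squareLine G.toCover hd)
  · linarith
  · intro a p x ha hp h0
    refine sqVec_ne_zero (hs p.2 p.1 x hp.2 hp.1) ?_
    have h0' : T.f a p.2 x * sqVec (s.f p.2 p.1 x) = 0 := h0
    rw [← Matrix.one_mul (sqVec _), ← Matrix.nonsing_inv_mul _ hq₃, ← hT a p.2 x ha hp.2,
      Matrix.mul_assoc, Matrix.mul_assoc _ (T.f a p.2 x), h0', Matrix.mul_zero, Matrix.mul_zero]
  · intro a p x ha hp
    change (T.f a p.2 x * sqVec (s.f p.2 p.1 x))ᵀ * H.q a x *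
      (T.f a p.2 x * sqVec (s.f p.2 p.1 x)) = 0
    rw [← sqVec_isotropic (s.f p.2 p.1 x), ← hT a p.2 x ha hp.2, Matrix.transpose_mul]
    simp only [Matrix.mul_assoc]
  · intro a p c x ha hp hc
    change H.β.f PUnit.unit a c x * (T.f a p.2 x * sqVec (s.f p.2 p.1 x)) = 0
    obtain ⟨k, hk⟩ := hinv p.2 p.1 c x hp.2 hp.1 hc
    have hcomm : H.β.f PUnit.unit a c x * T.f a p.2 x = betaMat (G.φ.f p.2 p.2 c x) :=
      T.comm a p.2 c x ha hp.2 hc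
    rw [← Matrix.mul_assoc, hcomm]
    exact betaMat_mul_sqVec_of_eigenvector (G.trace_φ _ c x hp.2 hc) hk

end Semistability

/-! ### S-equivalence -/

section SEquivalence

variable {X : Type u} [TopologicalSpace X] [ChartedSpace ℂ X] [IsManifold 𝓘(ℂ) ω X]

/-- `Sym²` of an isomorphism of `SL(2, ℂ)`-Higgs bundles. -/
def SL2Higgs.Iso.sym2 {H H' : SL2Higgs X} (T : SL2Higgs.Iso H H') :
    SO13Higgs.Iso H.sym2 H'.sym2 where
  f a i x := sym2Mat (T.f a i x)
  hol a i := by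
    have h := T.hol a i
    intro r t
    fin_cases r <;> fin_cases t <;> simp only [sym2Mat, pow_two] <;>
      first
        | exact (h _ _).mul (h _ _)
        | exact (holOn_const 2 _).mul ((h _ _).mul (h _ _))
        | exact ((h _ _).mul (h _ _)).add ((h _ _).mul (h _ _))
  compat a b i j x ha hb hi hj := by
    rw [T.compat a b i j x ha hb hi hj, sym2Mat_mul, sym2Mat_mul]
    rfl
  isometry a i x ha hi := sym2Mat_isometry (T.det_f a i x ha hi)
  orient a i x ha hi := by
    rw [det_sym2Mat (T.det_f a i x ha hi), one_mul]
    rfl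
  comm a i c x ha hi hc := by
    change betaMat (H'.φ.f a a c x) * sym2Mat (T.f a i x) = betaMat (H.φ.f i i c x)
    have hdet := T.det_f a i x ha hi
    have hadj : (T.f a i x).adjugate * T.f a i x = 1 := by
      rw [Matrix.adjugate_mul, hdet, one_smul]
    rw [← betaMat_conj hdet hadj (H'.trace_φ a c x ha hc), mul_assoc, T.comm a i c x ha hi hc,
      ← mul_assoc, hadj, one_mul]

theorem SL2Higgs.IsTriangular.sym2 {H : SL2Higgs X} (h : H.IsTriangular) :
    H.sym2.IsTriangular := by
  refine ⟨fun i j x hi hj => ?_, fun i x hi => ?_, fun i c x hi hc => ?_⟩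
  · have := h.1 i j x hi hj
    simp [SL2Higgs.sym2, SL2Bundle.sym2, sym2Mat, this]
  · simp [SL2Higgs.sym2, SL2Bundle.sym2, q₃]
  · simp [SL2Higgs.sym2, betaMat, h.2 i c x hi hc]

/-- `Sym²` commutes with passing to the associated graded. -/
def SL2Higgs.Iso.sym2OfGr {H H' : SL2Higgs X} (h : H.IsTriangular)
    (T : SL2Higgs.Iso (H.gr h) H') : SO13Higgs.Iso (H.sym2.gr h.sym2) H'.sym2 where
  f := T.sym2.f
  hol := T.sym2.hol
  compat a b i j x ha hb hi hj := by
    have hg : (H.sym2.gr h.sym2).g i j x = (H.gr h).sym2.g i j x := by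
      have h0 : H.g i j x 1 0 = 0 := h.1 i j x hi hj
      change (Matrix.diagonal fun r => sym2Mat (H.g i j x) r r) =
        sym2Mat (Matrix.diagonal fun r => H.g i j x r r)
      ext r t
      fin_cases r <;> fin_cases t <;> simp [sym2Mat, h0]
    rw [hg]
    exact T.sym2.compat a b i j x ha hb hi hj
  isometry a i x ha hi := by
    have hq : (H.sym2.gr h.sym2).q i x = (H.gr h).sym2.q i x := by
      change !![0, 0, q₃ 0 2; 0, q₃ 1 1, 0; q₃ 2 0, 0, 0] = q₃
      ext r t
      fin_cases r <;> fin_cases t <;> simp [q₃]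
    rw [hq]
    exact T.sym2.isometry a i x ha hi
  orient := T.sym2.orient
  comm a i c x ha hi hc := by
    have hb : (H.sym2.gr h.sym2).β.f PUnit.unit i c x = (H.gr h).sym2.β.f PUnit.unit i c x := by
      change !![0, betaMat (H.φ.f i i c x) 0 1, 0] =
        betaMat (Matrix.diagonal fun r => H.φ.f i i c x r r)
      ext r t
      fin_cases r
      fin_cases t <;> simp [betaMat]
    rw [hb]
    exact T.sym2.comm a i c x ha hi hc

/-- The map `(V, φ) ↦ (Sym² V, β)` on moduli spaces. -/
def moduliSym2 : ModuliSL2 X → ModuliSO13 X :=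
  Quot.map (fun H => ⟨H.1.sym2, H.2.sym2⟩) fun _ _ hR => by
    rcases hR with ⟨⟨T⟩⟩ | ⟨h, ⟨T⟩⟩
    · exact Or.inl ⟨T.sym2⟩
    · exact Or.inr ⟨h.sym2, ⟨T.sym2OfGr h⟩⟩

theorem range_moduliSym2 : Set.range (moduliSym2 (X := X)) = ModuliSO13Plus X := by
  apply Set.Subset.antisymm
  · rintro _ ⟨⟨H, hH⟩, rfl⟩
    exact ⟨H.sym2, hH.sym2, H.sym2_w2EqZero, rfl⟩
  · rintro _ ⟨H, hH, hw, rfl⟩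
    obtain ⟨G, ⟨T⟩⟩ := H.exists_sym2_iso hw
    exact ⟨ModuliSL2.mk G (SL2Higgs.isSemistable_of_sym2_iso T hH), Quot.sound (Or.inl ⟨T⟩)⟩

end SEquivalence

end Higgs

end

theorem theoremA {X : Type u} [TopologicalSpace X] [T2Space X] [CompactSpace X] [ConnectedSpace X]
    [ChartedSpace ℂ X] [IsManifold 𝓘(ℂ) ω X] :
    (∀ H : Higgs.SL2Higgs X,
      (∀ i c x, x ∈ H.U i → x ∈ (Higgs.canonical X).U c →
        H.sym2.β.f PUnit.unit i c x =
          !![-(H.φ.f i i c x 1 0), 2 * H.φ.f i i c x 0 0, H.φ.f i i c x 0 1]) ∧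
      ∃ T : Higgs.SOHiggs.Iso H.sym2.toSO4 (Higgs.isogeny H H.neg),
        ∀ i, ∀ x ∈ H.U i, T.f (i, i) (PUnit.unit, i) x = Higgs.frameMat) ∧
    (∀ H : Higgs.SO13Higgs X, H.W2EqZero →
      ∃ G : Higgs.SL2Higgs X, Nonempty (Higgs.SO13Higgs.Iso G.sym2 H)) ∧
    ∃ F : Higgs.ModuliSL2 X → Higgs.ModuliSO13 X,
      (∀ (H : Higgs.SL2Higgs X) (h : H.IsSemistable), ∃ h' : H.sym2.IsSemistable,
        F (Higgs.ModuliSL2.mk H h) = Higgs.ModuliSO13.mk H.sym2 h') ∧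
      Set.range F = Higgs.ModuliSO13Plus X := by
  exact ⟨fun H => ⟨fun _ _ _ _ _ => rfl, H.isogenyIso, fun i _ hi => H.isogenyIso_f i hi⟩,
    fun H hw => H.exists_sym2_iso hw,
    Higgs.moduliSym2, fun _ h => ⟨h.sym2, rfl⟩, Higgs.range_moduliSym2⟩
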